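/- Let $n\ge 2$ and $\Delta\ge 1$ be integers, let $V$ be a set of $n$ nodes and $\mathcal C$ a set of $\Delta+1$ colors. An edge-less graph on $V$ undergoes a sequence of $t$ updates (insertions of absent edges, deletions of present edges), such that all degrees are at most $\Delta$ at all times; the sequence is fixed in advance, independently of the random choices below. Consider the following randomized data structure. It maintains a coloring $\chi:V\to\mathcal C$ and a level $\ell(v)\in\{-1,0,\dots,L\}$ for each node, $L=\lceil\log_3(n-1)\rceil-1$; initially $\chi$ is arbitrary and all levels are $-1$. An up-neighbor (down-neighbor) of $x$ is a neighbor $u$ with $\ell(u)\ge\ell(x)$ (with $\ell(u)<\ell(x)$), and $\phi_x(k)$ is the number of neighbors of $x$ at levels less than $k$. Deletions, and insertions of edges $uv$ with $\chi(u)\ne\chi(v)$, change no color and no level. After the insertion of an edge $uv$ with $\chi(u)=\chi(v)$, let $x\in\{u,v\}$ be the endpoint that was recolored last (either one, if neither was recolored before) and repeat $x\leftarrow\mathtt{recolor}(x)$ until $x=\mathrm{NULL}$, where $\mathtt{recolor}(x)$ is as follows. - If $\phi_x(\ell(x)+1)<3^{\ell(x)+2}$: give $x$ a color that no neighbor of $x$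 has, set $\ell(x)\leftarrow-1$, and return NULL. - Otherwise: set $\ell(x)\leftarrow\ell'$, the least $\ell'>\ell(x)$ with $\phi_x(\ell'+1)<3^{\ell'+2}$. Then give $x$ a color $c$ drawn uniformly at random from all colors that no up-neighbor and at most one down-neighbor of $x$ has. Return the down-neighbor of $x$ with color $c$, if there is one, and NULL otherwise. The data structure is implemented with the following memory: for each node $v$, its level, color and time stamp of its last recoloring, a linked list of its down-neighbors, for each level $k\ge\ell(v)$ a linked list of its neighbors at level $k$, for each color the number of up-neighbors of $v$ with this color, and an indexed array of the colors that no up-neighbor of $v$ has. When $x$ changes its color or its level, only the neighbors of $x$ up to the larger one of its old and its new level are visited, and their records and those of $x$ are updated. A deterministic recoloring tabulates the colors of the down-neighbors of $x$ and scans the array of $x$ up to the first unused color; a random recoloring tabulates the colors of the down-neighbors of $x$, takes those of two or more down-neighbors out of the array, draws a uniformly random entry, and undoes these deletions. The running time is the number of elementary steps, where each list, array or counter operation, each scanned list or array entry, each tested level and each random draw counts $O(1)$; preprocessing counts one step for each memory cell that is initialized ($O(\log n+\Delta)$ cells per node, plus one table with an entry for each color). Then there is an absolute constant $K>0$, and for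 every $a>0$ there is a constant $C>0$ depending only on $a$, such that for all $n$, $\Delta$, initial colorings and update sequences as above, with probability at least $1-K\,\frac{\log n}{n^{a}}$ the total running time of the data structure over the $t$ updates, including preprocessing, is at most $C\,(t+n\log n+\Delta n)$. -/

import Mathlib

namespace DynColoring

/-- An update of a dynamic graph on the nodes `0, …, n - 1`: insertion or deletion of an edge. -/
inductive Update (n : ℕ) where
  | insert (u v : Fin n) : Update n
  | delete (u v : Fin n) : Update n

/-- The graph after an update. -/
def Update.apply {n : ℕ} (G : SimpleGraph (Fin n)) : Update n → SimpleGraph (Fin n)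
  | .insert u v => G ⊔ SimpleGraph.edge u v
  | .delete u v => G.deleteEdges {s(u, v)}

/-- Only absent edges between distinct nodes are inserted, only present edges are deleted. -/
def Update.Legal {n : ℕ} (G : SimpleGraph (Fin n)) : Update n → Prop
  | .insert u v => u ≠ v ∧ ¬ G.Adj u v
  | .delete u v => G.Adj u v

/-- The update sequence can be applied to `G`, and all degrees stay at most `Δ` throughout. -/
def Admissible {n : ℕ} (Δ : ℕ) : SimpleGraph (Fin n) → List (Update n) → Prop
  | _, [] => True
  | G, e :: es => e.Legal G ∧ (∀ v, ((e.apply G).neighborSet v).ncard ≤ Δ) ∧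
      Admissible Δ (e.apply G) es

/-- The memory of the data structure. Levels are stored shifted by one: a node `v` with
`level v = j` is at level `ℓ(v) = j - 1`, so the lowest level `-1` is stored as `0`. -/
structure State (n Δ : ℕ) where
  /-- the shifted level of each node -/
  level : Fin n → ℕ
  /-- the current color of each node -/
  color : Fin n → Fin (Δ + 1)
  /-- the serial number of the last recoloring of each node (`0` if it was never recolored) -/
  stamp : Fin n → ℕ
  /-- the number of recolorings so far -/
  calls : ℕ
  /-- `down v`: linked list of the neighbors of `v` at levels lower than `v` -/
  down : Fin n → List (Fin n)
  /-- `up v j`: linked list of the neighbors of `v` at (shifted) level `j`, for `level v ≤ j` -/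
  up : Fin n → ℕ → List (Fin n)
  /-- `mu v c`: the number of up-neighbors of `v` (those in the lists `up v j`) with color `c` -/
  mu : Fin n → Fin (Δ + 1) → ℕ
  /-- `free v`: array (with a table of positions) of the colors taken by no up-neighbor of `v` -/
  free : Fin n → List (Fin (Δ + 1))
  /-- the number of elementary steps executed so far -/
  time : ℕ

/-- The largest shifted level, `L + 1` where `L = ⌈log₃ (n - 1)⌉ - 1`. -/
def topLevel (n : ℕ) : ℕ := Nat.clog 3 (n - 1)

/-- Deletion from an array: the last entry is moved into the slot of the deleted entry. -/
def swapRemove {α : Type} [DecidableEq α] (l : List α) (a : α) : List α :=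
  match l.getLast? with
  | none => []
  | some b => l.dropLast.map fun x => if x = a then b else x

namespace State

variable {n Δ : ℕ}

/-- Spend `k` elementary steps. -/
def tick (k : ℕ) (s : State n Δ) : State n Δ := { s with time := s.time + k }

/-- Node `v` gets one more up-neighbor with color `c`. -/
def incColor (v : Fin n) (c : Fin (Δ + 1)) (s : State n Δ) : State n Δ :=
  { s with
    free := if s.mu v c = 0 then Function.update s.free v (swapRemove (s.free v) c) else s.free
    mu := Function.update s.mu v (Function.update (s.mu v) c (s.mu v c + 1))
    time := s.time + 1 }

/-- Node `v` loses one up-neighbor with color `c`. -/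
def decColor (v : Fin n) (c : Fin (Δ + 1)) (s : State n Δ) : State n Δ :=
  { s with
    free := if s.mu v c = 1 then Function.update s.free v (s.free v ++ [c]) else s.free
    mu := Function.update s.mu v (Function.update (s.mu v) c (s.mu v c - 1))
    time := s.time + 1 }

/-- Enter the neighbor `w` into the structures of `v`, according to the current levels. -/
def attach (v w : Fin n) (s : State n Δ) : State n Δ :=
  if s.level w < s.level v then
    { s with down := Function.update s.down v (w :: s.down v), time := s.time + 1 }
  else
    incColor v (s.color w)
      { s with
        up := Function.update s.up v
          (Function.update (s.up v) (s.level w) (w :: s.up v (s.level w)))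
        time := s.time + 1 }

/-- Delete the neighbor `w` from the structures of `v`, according to the current levels. -/
def detach (v w : Fin n) (s : State n Δ) : State n Δ :=
  if s.level w < s.level v then
    { s with down := Function.update s.down v ((s.down v).erase w), time := s.time + 1 }
  else
    decColor v (s.color w)
      { s with
        up := Function.update s.up v
          (Function.update (s.up v) (s.level w) ((s.up v (s.level w)).erase w))
        time := s.time + 1 }

/-- Enter the edge `uv` into the structures of both endpoints. -/
def link (u v : Fin n) (s : State n Δ) : State n Δ := attach v u (attach u v s)

/-- Delete the edge `uv` from the structures of both endpoints. -/
def unlink (u v : Fin n) (s : State n Δ) : State n Δ := detach v u (detach u v s)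

/-- For `level x ≤ m`: the neighbors of `x` whose shifted level is at most `m`, read off from
`down x` and from the lists `up x j` with `level x ≤ j ≤ m`. -/
def below (s : State n Δ) (x : Fin n) (m : ℕ) : List (Fin n) :=
  s.down x ++ (List.range' (s.level x) (m + 1 - s.level x)).flatMap (s.up x)

/-- `φ_x(ℓ + 1)` where `ℓ = m - 1`: the number of neighbors of `x` of shifted level at most `m`,
the sum of the (stored) lengths of the lists in `below s x m`. -/
def phi (s : State n Δ) (x : Fin n) (m : ℕ) : ℕ := (below s x m).length

/-- Give node `x` the shifted level `m` and the color `c`, and update all structures. Only the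
neighbors up to the larger one of the old and the new level of `x` are visited: those above it
have `x` in their list of down-neighbors before and after, where no color is stored.
One step for each list of neighbors that is opened, one for each neighbor in them, and the steps
of deleting and entering the edges to these neighbors. -/
def move (x : Fin n) (m : ℕ) (c : Fin (Δ + 1)) (s : State n Δ) : State n Δ :=
  let b := max (s.level x) m
  let A := below s x b
  let s₁ := A.foldl (fun r w => unlink x w r) (tick (b + 2 - s.level x + A.length) s)
  let s₂ : State n Δ :=
    { s₁ with
      level := Function.update s₁.level x m
      color := Function.update s₁.color x c
      time := s₁.time + 1 }
  A.foldl (fun r w => link x w r) s₂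

/-- The number of down-neighbors of `x` with color `c`. For all colors together, this table is
filled by one pass over `down x` (reading the current colors there), and cleared by another. -/
def occ (s : State n Δ) (x : Fin n) (c : Fin (Δ + 1)) : ℕ :=
  (s.down x).countP fun w => s.color w = c

/-- Record that `x` is the node recolored last. -/
def mark (x : Fin n) (s : State n Δ) : State n Δ :=
  { s with
    stamp := Function.update s.stamp x (s.calls + 1)
    calls := s.calls + 1
    time := s.time + 1 }

/-- `det-color(x)`: scan the array `free x` up to the first blank color `c`, the color of no
neighbor of `x`; give it to `x`, and move `x` to the lowest level.
Two passes over `down x` for the table `occ`, one step for each color that is scanned. -/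
def detColor (x : Fin n) (s : State n Δ) : State n Δ :=
  let i := (s.free x).findIdx fun c => occ s x c = 0
  let c := ((s.free x)[i]?).getD (s.color x)
  mark x (move x 0 c (tick (2 * (s.down x).length + (i + 1)) s))

/-- The smallest level `ℓ' > ℓ(x)` with `φ_x(ℓ' + 1) < 3 ^ (ℓ' + 2)` (shifted: `m = ℓ' + 1`). -/
def targetLevel (s : State n Δ) (x : Fin n) : ℕ :=
  ((List.range' (s.level x + 1) (topLevel n - s.level x)).find?
    fun m => phi s x m < 3 ^ (m + 1)).getD (topLevel n)

/-- First part of `rand-color(x)`: move `x` up to its target level, with one step for each level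
that is tested. -/
def raise (x : Fin n) (s : State n Δ) : State n Δ :=
  move x (targetLevel s x) (s.color x) (tick (targetLevel s x + 1 - s.level x) s)

/-- The palette of `x`: the blank and unique colors, that is, the colors of no up-neighbor and of
at most one down-neighbor. A pass over `down x` takes the colors of two or more down-neighbors
out of the array `free x`; these deletions are undone after a color has been drawn. -/
def palette (s : State n Δ) (x : Fin n) : List (Fin (Δ + 1)) :=
  (s.down x).foldl
    (fun l w => if 2 ≤ occ s x (s.color w) ∧ s.color w ∈ l then swapRemove l (s.color w) else l)
    (s.free x)

/-- Last part of `rand-color(x)`, after the color `c` has been drawn from the palette: recolor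
`x` with `c`, and return the down-neighbor that had the color `c`, if there is one.
Five passes over `down x`: two for the table `occ`, two for taking colors out of `free x` and
putting them back, one for the search of the returned node; one step for the random draw. -/
def finish (x : Fin n) (s : State n Δ) (c : Fin (Δ + 1)) : Option (Fin n) × State n Δ :=
  ((s.down x).find? fun w => s.color w = c,
    mark x (move x (s.level x) c (tick (5 * (s.down x).length + 1) s)))

/-- `rand-color(x)`: move `x` up to its target level, recolor it with a color drawn uniformly at
random from its palette there, and return the down-neighbor in conflict with `x`, if any. (The
palette is never empty for a graph of maximum degree at most `Δ`.) -/
noncomputable def randColor (x : Fin n) (s : State n Δ) : PMF (Option (Fin n) × State n Δ) :=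
  let r := raise x s
  if h : (palette r x).toFinset.Nonempty then
    (PMF.uniformOfFinset (palette r x).toFinset h).map (finish x r)
  else PMF.pure (none, r)

/-- `recolor(x)`. In shifted levels, the test `φ_x(ℓ(x) + 1) < 3 ^ (ℓ(x) + 2)` reads as below. -/
noncomputable def recolor (x : Fin n) (s : State n Δ) : PMF (Option (Fin n) × State n Δ) :=
  if phi s x (s.level x) < 3 ^ (s.level x + 1) then
    PMF.pure (none, detColor x (tick 1 s))
  else randColor x (tick 1 s)

/-- The loop `while x ≠ NULL: x ← recolor(x)`, with at most the given number of iterations. -/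
noncomputable def recolorLoop : ℕ → Fin n → State n Δ → PMF (State n Δ)
  | 0, _, s => PMF.pure s
  | k + 1, x, s => (recolor x s).bind fun p =>
      match p.1 with
      | none => PMF.pure p.2
      | some y => recolorLoop k y p.2

/-- Handling an update. If an insertion creates a conflict, then the endpoint that was recolored
last is recolored. Every call to `recolor` in the loop but the last one raises the level of one
node and keeps the other levels, so the loop ends after at most `n * topLevel n + 1` iterations. -/
noncomputable def handle (s : State n Δ) : Update n → PMF (State n Δ)
  | .insert u v =>
      let s' := link u v (tick 1 s)
      if s.color u = s.color v then
        recolorLoop (n * topLevel n + 1) (if s.stamp u < s.stamp v then v else u) s'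
      else PMF.pure s'
  | .delete u v => PMF.pure (unlink u v (tick 1 s))

/-- Handling a sequence of updates, one after the other. -/
noncomputable def run : List (Update n) → State n Δ → PMF (State n Δ)
  | [], s => PMF.pure s
  | e :: es, s => (handle s e).bind (run es)

/-- The state after preprocessing: no edges, all nodes at the lowest level, with any colors `χ₀`.
The preprocessing writes every memory cell once: for each node one head of a list `up v j` for
each level, the counters `mu v`, the array `free v` and its table of positions, and five single
cells (level, color, stamp, head of `down v`, length of `free v`), and moreover one table with an
entry for each color that serves as `occ`. -/
def init (χ₀ : Fin n → Fin (Δ + 1)) : State n Δ where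
  level := fun _ => 0
  color := χ₀
  stamp := fun _ => 0
  calls := 0
  down := fun _ => []
  up := fun _ _ => []
  mu := fun _ _ => 0
  free := fun _ => List.finRange (Δ + 1)
  time := n * ((topLevel n + 1) + 3 * (Δ + 1) + 5) + (Δ + 1)

end State

/-- The distribution of the total running time, preprocessing included, of the data structure
with initial coloring `χ₀` on the (fixed) sequence `us` of updates. -/
noncomputable def totalTime {n Δ : ℕ} (χ₀ : Fin n → Fin (Δ + 1)) (us : List (Update n)) : PMF ℕ :=
  (State.run us (State.init χ₀)).map State.time

end DynColoring

/-!
The running time is bounded by a potential argument under an exponential supermartingale.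

Levels are shifted, so that the lowest one is `0`. An epoch of a node at level `k` costs
`O(3 ^ k)`: up to that level there are fewer than `3 ^ (k + 1)` neighbors, and these are all that
is visited when the epoch begins at random and when it ends by a deterministic recoloring
(`raise_spec`, `finish_spec`, `detColor_spec`; that the records describe the graph is `Rep.move`).
An epoch ends either because the beginning of an epoch of another node at a higher level has taken
its color, or because of an insertion. In the first case its cost is at most a third of that of the
new epoch. In the second case the epoch was either ended by one of the first `3 ^ k / 18`
insertions at its node `x`, or its cost can be charged to these insertions, `O(1)` to each.

The first alternative is rare. Its node `x` has a later time stamp than the other endpoint, so that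
endpoint has kept its color since the draw of the color of `x`. As the updates are fixed in advance,
an early end therefore requires that `x` draws one of at most `3 ^ k / 18` colors that are
determined before the draw (`card_filter_reserve_lt`). The palette has at least `3 ^ k / 2` colors,
because `x` has at least `3 ^ k` down-neighbors, and only one color per up-neighbor and one per two
down-neighbors is excluded (`length_down_le_palette`). So the probability is at most `1 / 9`.

The potential `pot` of a node is a function of the state and of the updates still to come: it
measures, in units of insertions at the node and up to the cost of its epoch, how far away the first
insertion is that would end the epoch if no colors changed. Recoloring another node can only
increase it (`Recolored.pot_le`). With `θ = 1 / (400 n)` and `F` the running time minus all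
potentials, `exp (θ F)` grows by a factor of at most `exp (O(θ))` in the mean per update
(`mean_randColor_le`, `mean_handle_le`): all costs are `O(n)`, so at this scale the exponential is
essentially linear. Since the potentials sum up to `O(Δ n)`, Markov's inequality bounds the
probability that the time exceeds its bound by `400 a n log n` by `exp (-a log n) = n ^ (-a)`.
-/

/-! ### Correctness of the records -/

namespace DynColoring

theorem mem_swapRemove {α : Type} [DecidableEq α] {l : List α} {a : α} (hl : l.Nodup)
    (ha : a ∈ l) (c : α) : c ∈ swapRemove l a ↔ c ∈ l ∧ c ≠ a := by
  obtain ⟨b, l', rfl⟩ : ∃ b l', l = l' ++ [b] := by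
    rcases List.eq_nil_or_concat l with h | ⟨l', b, h⟩
    · simp [h] at ha
    · exact ⟨b, l', by simpa using h⟩
  have hb : b ∉ l' := by
    intro h
    exact (List.disjoint_of_nodup_append hl) h (by simp)
  simp only [swapRemove, List.getLast?_append, List.getLast?_singleton,
    Option.some_or, List.dropLast_concat, List.mem_map, List.mem_append,
    List.mem_singleton, ne_eq] at *
  grind

theorem nodup_swapRemove {α : Type} [DecidableEq α] {l : List α} {a : α} (hl : l.Nodup) :
    (swapRemove l a).Nodup := by
  rcases List.eq_nil_or_concat l with rfl | ⟨l', b, h⟩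
  · simp [swapRemove]
  · obtain rfl : l = l' ++ [b] := by simpa using h
    have hb : b ∉ l' := by
      intro h
      exact (List.disjoint_of_nodup_append hl) h (by simp)
    have hn : l'.Nodup := (List.nodup_append.1 hl).1
    simp only [swapRemove, List.getLast?_append, List.getLast?_singleton, Option.some_or,
      List.dropLast_concat]
    refine List.Nodup.map_on ?_ hn
    grind

namespace State

variable {n Δ : ℕ}

/-- The lists, counters and arrays of `s` describe the graph in which the neighbors of `v` are the
`w` with `R v w`, for the current levels and colors. The relation is not required to be symmetric,
so that the state after entering or deleting only one direction of an edge is covered. -/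
structure Rep (R : Fin n → Fin n → Prop) (s : State n Δ) : Prop where
  down_nodup : ∀ v, (s.down v).Nodup
  mem_down : ∀ v w, w ∈ s.down v ↔ R v w ∧ s.level w < s.level v
  up_nodup : ∀ v j, (s.up v j).Nodup
  mem_up : ∀ v j w, w ∈ s.up v j ↔ R v w ∧ s.level v ≤ s.level w ∧ s.level w = j
  mu_eq : ∀ v c, s.mu v c = {w | R v w ∧ s.level v ≤ s.level w ∧ s.color w = c}.ncard
  free_nodup : ∀ v, (s.free v).Nodup
  mem_free : ∀ v c, c ∈ s.free v ↔ s.mu v c = 0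

/-- `s'` has the levels, colors and recoloring times of `s`, and its clock shows at most `k` more
steps. -/
structure Frame (k : ℕ) (s s' : State n Δ) : Prop where
  level : s'.level = s.level
  color : s'.color = s.color
  stamp : s'.stamp = s.stamp
  calls : s'.calls = s.calls
  time : s'.time ≤ s.time + k

theorem Frame.refl (s : State n Δ) : Frame 0 s s := ⟨rfl, rfl, rfl, rfl, le_rfl⟩

theorem Frame.trans {k l : ℕ} {s s' s'' : State n Δ} (h : Frame k s s') (h' : Frame l s' s'') :
    Frame (k + l) s s'' :=
  ⟨h'.level.trans h.level, h'.color.trans h.color, h'.stamp.trans h.stamp,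
    h'.calls.trans h.calls, by have := h.time; have := h'.time; omega⟩

theorem frame_tick (k : ℕ) (s : State n Δ) : Frame k s (tick k s) :=
  ⟨rfl, rfl, rfl, rfl, le_rfl⟩

theorem frame_attach (v w : Fin n) (s : State n Δ) : Frame 2 s (attach v w s) := by
  unfold attach incColor
  split <;> constructor <;> simp

theorem frame_detach (v w : Fin n) (s : State n Δ) : Frame 2 s (detach v w s) := by
  unfold detach decColor
  split <;> constructor <;> simp

theorem frame_link (u v : Fin n) (s : State n Δ) : Frame 4 s (link u v s) :=
  (frame_attach u v s).trans (frame_attach v u _)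

theorem frame_unlink (u v : Fin n) (s : State n Δ) : Frame 4 s (unlink u v s) :=
  (frame_detach u v s).trans (frame_detach v u _)

theorem Rep.congr {R R' : Fin n → Fin n → Prop} {s : State n Δ} (h : Rep R s)
    (hR : ∀ a b, R a b ↔ R' a b) : Rep R' s := by
  have : R = R' := by ext a b; exact hR a b
  exact this ▸ h

theorem Rep.attach {R : Fin n → Fin n → Prop} {s : State n Δ} (h : Rep R s) {v w : Fin n}
    (hvw : ¬ R v w) : Rep (fun a b => R a b ∨ (a = v ∧ b = w)) (attach v w s) := by
  obtain ⟨h1, h2, h3, h4, h5, h6, h7⟩ := h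
  unfold State.attach
  split_ifs with hl
  · refine ⟨?_, ?_, h3, ?_, ?_, h6, h7⟩
    · intro a
      simp only [Function.update_apply]
      grind
    · intro a b
      simp only [Function.update_apply]
      grind
    · intro a j b
      simp only
      grind
    · intro a c
      simp only
      rw [h5]
      congr 1
      ext b
      simp only [Set.mem_ofPred_eq]
      grind
  · push Not at hl
    have hmu : ∀ a c, (incColor v (s.color w) s).mu a c =
        {b | (R a b ∨ (a = v ∧ b = w)) ∧ s.level a ≤ s.level b ∧ s.color b = c}.ncard := by
      intro a c
      simp only [incColor, Function.update_apply, ite_apply]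
      by_cases ha : a = v
      · subst ha
        by_cases hc : c = s.color w
        · subst hc
          simp only [if_true]
          rw [h5, ← Set.ncard_insert_of_notMem (a := w) (by simp [hvw])]
          congr 1
          ext b
          simp only [Set.mem_ofPred_eq, Set.mem_insert_iff]
          grind
        · simp only [if_true, hc, if_false]
          rw [h5]
          congr 1
          ext b
          simp only [Set.mem_ofPred_eq]
          grind
      · simp only [ha, if_false]
        rw [h5]
        congr 1
        ext b
        simp only [Set.mem_ofPred_eq]
        grind
    refine ⟨h1, ?_, ?_, ?_, hmu, ?_, ?_⟩
    · intro a b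
      simp only [incColor]
      grind
    · intro a j
      simp only [incColor, Function.update_apply, ite_apply]
      split_ifs with ha hj <;> grind
    · intro a j b
      simp only [incColor, Function.update_apply, ite_apply]
      split_ifs with ha hj <;> grind
    · intro a
      simp only [incColor]
      split_ifs with h0
      · simp only [Function.update_apply]
        split_ifs with ha
        · exact nodup_swapRemove (h6 v)
        · exact h6 a
      · exact h6 a
    · intro a c
      simp only [incColor]
      split_ifs with h0
      · simp only [Function.update_apply, ite_apply]
        split_ifs with ha hc
        · rw [mem_swapRemove (h6 v) ((h7 _ _).2 h0)]
          simp [hc]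
        · subst ha
          rw [mem_swapRemove (h6 a) ((h7 _ _).2 h0), h7]
          simp [hc]
        · exact h7 a c
      · simp only [Function.update_apply, ite_apply]
        split_ifs with ha hc
        · subst ha hc
          rw [h7]; simp [h0]
        · subst ha
          exact h7 _ _
        · exact h7 a c

theorem Rep.detach {R : Fin n → Fin n → Prop} {s : State n Δ} (h : Rep R s) {v w : Fin n}
    (hvw : R v w) : Rep (fun a b => R a b ∧ ¬ (a = v ∧ b = w)) (detach v w s) := by
  obtain ⟨h1, h2, h3, h4, h5, h6, h7⟩ := h
  unfold State.detach
  split_ifs with hl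
  · refine ⟨?_, ?_, h3, ?_, ?_, h6, h7⟩
    · intro a
      simp only [Function.update_apply]
      split_ifs
      · exact (h1 v).erase _
      · exact h1 a
    · intro a b
      simp only [Function.update_apply]
      split_ifs with ha
      · rw [(h1 v).mem_erase_iff]
        grind
      · grind
    · intro a j b
      simp only
      grind
    · intro a c
      simp only
      rw [h5]
      congr 1
      ext b
      simp only [Set.mem_ofPred_eq]
      grind
  · push Not at hl
    have hmu : ∀ a c, (decColor v (s.color w) s).mu a c =
        {b | (R a b ∧ ¬ (a = v ∧ b = w)) ∧ s.level a ≤ s.level b ∧ s.color b = c}.ncard := by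
      intro a c
      simp only [decColor, Function.update_apply, ite_apply]
      by_cases ha : a = v
      · subst ha
        by_cases hc : c = s.color w
        · subst hc
          simp only [if_true]
          rw [h5, ← Set.ncard_sdiff_singleton_of_mem (a := w) (by simp [hvw, hl])]
          congr 1
          ext b
          simp only [Set.mem_ofPred_eq, Set.mem_sdiff, Set.mem_singleton_iff]
          grind
        · simp only [if_true, hc, if_false]
          rw [h5]
          congr 1
          ext b
          simp only [Set.mem_ofPred_eq]
          grind
      · simp only [ha, if_false]
        rw [h5]
        congr 1
        ext b
        simp only [Set.mem_ofPred_eq]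
        grind
    have hpos : s.mu v (s.color w) ≠ 0 := by
      rw [h5]
      exact Set.ncard_ne_zero_of_mem (a := w) ⟨hvw, hl, rfl⟩
    refine ⟨h1, ?_, ?_, ?_, hmu, ?_, ?_⟩
    · intro a b
      simp only [decColor]
      grind
    · intro a j
      simp only [decColor, Function.update_apply, ite_apply]
      split_ifs with ha hj
      · exact (h3 _ _).erase _
      · exact h3 _ _
      · exact h3 _ _
    · intro a j b
      simp only [decColor, Function.update_apply, ite_apply]
      split_ifs with ha hj
      · rw [(h3 _ _).mem_erase_iff]
        grind
      · grind
      · grind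
    · intro a
      simp only [decColor]
      split_ifs with h0
      · simp only [Function.update_apply]
        split_ifs with ha
        · have := h7 v (s.color w)
          have := h6 v
          rw [List.nodup_append]
          grind
        · exact h6 a
      · exact h6 a
    · intro a c
      simp only [decColor]
      split_ifs with h0
      · simp only [Function.update_apply, ite_apply]
        split_ifs with ha hc
        · simp [hc, h0]
        · subst ha
          simp [hc, h7]
        · exact h7 a c
      · simp only [Function.update_apply, ite_apply]
        split_ifs with ha hc
        · subst ha hc
          rw [h7]; omega
        · subst ha
          exact h7 _ _
        · exact h7 a c

theorem Rep.link {R : Fin n → Fin n → Prop} {s : State n Δ} (h : Rep R s) {u v : Fin n}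
    (huv : u ≠ v) (h1 : ¬ R u v) (h2 : ¬ R v u) :
    Rep (fun a b => R a b ∨ (a = u ∧ b = v) ∨ (a = v ∧ b = u)) (link u v s) :=
  ((h.attach h1).attach (v := v) (w := u) (by grind)).congr (by grind)

theorem Rep.unlink {R : Fin n → Fin n → Prop} {s : State n Δ} (h : Rep R s) {u v : Fin n}
    (huv : u ≠ v) (h1 : R u v) (h2 : R v u) :
    Rep (fun a b => R a b ∧ ¬ (a = u ∧ b = v) ∧ ¬ (a = v ∧ b = u)) (unlink u v s) :=
  ((h.detach h1).detach (v := v) (w := u) (by grind)).congr (by grind)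

theorem frame_foldl {f : State n Δ → Fin n → State n Δ} {k : ℕ} (hf : ∀ s w, Frame k s (f s w))
    (A : List (Fin n)) (s : State n Δ) : Frame (k * A.length) s (A.foldl f s) := by
  induction A generalizing s with
  | nil => exact Frame.refl s
  | cons w A ih =>
    have := (hf s w).trans (ih (f s w))
    rw [List.length_cons, mul_add, mul_one, add_comm]
    exact this

theorem Rep.foldl_unlink {R : Fin n → Fin n → Prop} {s : State n Δ} (h : Rep R s) {x : Fin n}
    {A : List (Fin n)} (hA : A.Nodup) (hx : x ∉ A) (h1 : ∀ w ∈ A, R x w) (h2 : ∀ w ∈ A, R w x) :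
    Rep (fun a b => R a b ∧ ¬ (a = x ∧ b ∈ A) ∧ ¬ (b = x ∧ a ∈ A))
      (A.foldl (fun r w => State.unlink x w r) s) := by
  induction A generalizing R s with
  | nil => simpa using h
  | cons w A ih =>
    simp only [List.nodup_cons, List.mem_cons, not_or] at hA hx h1 h2
    have := ih (h.unlink (u := x) (v := w) hx.1 (by grind) (by grind)) hA.2 hx.2
      (by grind) (by grind)
    refine this.congr ?_
    intro a b
    simp only [List.mem_cons]
    grind

theorem Rep.foldl_link {R : Fin n → Fin n → Prop} {s : State n Δ} (h : Rep R s) {x : Fin n}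
    {A : List (Fin n)} (hA : A.Nodup) (hx : x ∉ A) (h1 : ∀ w ∈ A, ¬ R x w)
    (h2 : ∀ w ∈ A, ¬ R w x) :
    Rep (fun a b => R a b ∨ (a = x ∧ b ∈ A) ∨ (b = x ∧ a ∈ A))
      (A.foldl (fun r w => State.link x w r) s) := by
  induction A generalizing R s with
  | nil => simpa using h
  | cons w A ih =>
    simp only [List.nodup_cons, List.mem_cons, not_or] at hA hx h1 h2
    have := ih (h.link (u := x) (v := w) hx.1 (by grind) (by grind)) hA.2 hx.2
      (by grind) (by grind)
    refine this.congr ?_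
    intro a b
    simp only [List.mem_cons]
    grind

theorem Rep.tick {R : Fin n → Fin n → Prop} {s : State n Δ} (h : Rep R s) (k : ℕ) :
    Rep R (tick k s) := ⟨h.1, h.2, h.3, h.4, h.5, h.6, h.7⟩

/-- If all neighbors of `x` lie above its old and its new level, then no record depends on the
level or the color of `x`. -/
theorem Rep.relabel {R : Fin n → Fin n → Prop} {s : State n Δ} (h : Rep R s) {x : Fin n} {m : ℕ}
    {c : Fin (Δ + 1)} {t : ℕ} (hx : ¬ R x x)
    (h1 : ∀ w, R x w → s.level x < s.level w ∧ m < s.level w)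
    (h2 : ∀ w, R w x → s.level x < s.level w ∧ m < s.level w) :
    Rep R { s with
      level := Function.update s.level x m
      color := Function.update s.color x c
      time := t } := by
  refine ⟨h.1, ?_, h.3, ?_, ?_, h.6, h.7⟩
  · intro v w
    simp only [h.mem_down, Function.update_apply]
    grind
  · intro v j w
    simp only [h.mem_up, Function.update_apply]
    grind
  · intro v d
    simp only
    rw [h.mu_eq]
    congr 1
    ext w
    simp only [Set.mem_ofPred_eq, Function.update_apply]
    grind

theorem Rep.mem_below {R : Fin n → Fin n → Prop} {s : State n Δ} (h : Rep R s) {x : Fin n} {m : ℕ}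
    (hm : s.level x ≤ m) (w : Fin n) : w ∈ below s x m ↔ R x w ∧ s.level w ≤ m := by
  simp only [below, List.mem_append, h.mem_down, List.mem_flatMap, h.mem_up, List.mem_range'_1]
  constructor
  · rintro (⟨h1, h2⟩ | ⟨j, h1, h2, h3, h4⟩)
    · exact ⟨h1, by omega⟩
    · exact ⟨h2, by omega⟩
  · rintro ⟨h1, h2⟩
    by_cases hl : s.level w < s.level x
    · exact Or.inl ⟨h1, hl⟩
    · exact Or.inr ⟨s.level w, by omega, h1, by omega, rfl⟩

theorem Rep.nodup_below {R : Fin n → Fin n → Prop} {s : State n Δ} (h : Rep R s) (x : Fin n)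
    (m : ℕ) : (below s x m).Nodup := by
  simp only [below]
  rw [List.nodup_append]
  refine ⟨h.down_nodup x, ?_, ?_⟩
  · rw [List.nodup_flatMap]
    refine ⟨fun j _ => h.up_nodup x j, ?_⟩
    refine List.Pairwise.imp ?_ (List.nodup_range' (s := s.level x) (n := m + 1 - s.level x))
    intro i j hij w hi hj
    rw [h.mem_up] at hi hj
    exact hij (hi.2.2.symm.trans hj.2.2)
  · intro a ha b hb
    rw [h.mem_down] at ha
    simp only [List.mem_flatMap, h.mem_up] at hb
    rintro rfl
    obtain ⟨j, -, -, hb, -⟩ := hb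
    omega

theorem Rep.phi_eq {R : Fin n → Fin n → Prop} {s : State n Δ} (h : Rep R s) {x : Fin n} {m : ℕ}
    (hm : s.level x ≤ m) : phi s x m = {w | R x w ∧ s.level w ≤ m}.ncard := by
  rw [phi, ← List.toFinset_card_of_nodup (h.nodup_below x m), ← Set.ncard_coe_finset]
  congr 1
  ext w
  simp [h.mem_below hm]

theorem Rep.length_down {R : Fin n → Fin n → Prop} {s : State n Δ} (h : Rep R s) (x : Fin n) :
    (s.down x).length = {w | R x w ∧ s.level w < s.level x}.ncard := by
  rw [← List.toFinset_card_of_nodup (h.down_nodup x), ← Set.ncard_coe_finset]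
  congr 1
  ext w
  simp [h.mem_down]

/-- The effect of `move`: the records stay correct, and the cost is linear in the number of
neighbors up to the larger one of the two levels. -/
theorem Rep.move {R : Fin n → Fin n → Prop} {s : State n Δ} (h : Rep R s) (hirr : ∀ v, ¬ R v v)
    (hsymm : ∀ v w, R v w → R w v) (x : Fin n) (m : ℕ) (c : Fin (Δ + 1)) :
    Rep R (move x m c s) ∧ (move x m c s).level = Function.update s.level x m ∧
      (move x m c s).color = Function.update s.color x c ∧
      (move x m c s).stamp = s.stamp ∧ (move x m c s).calls = s.calls ∧
      (move x m c s).time ≤ s.time + (max (s.level x) m + 3 - s.level x) +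
        9 * phi s x (max (s.level x) m) := by
  set b := max (s.level x) m with hb
  set A := below s x b with hA
  have hxb : s.level x ≤ b := le_max_left _ _
  have hmb : m ≤ b := le_max_right _ _
  have hmem : ∀ w, w ∈ A ↔ R x w ∧ s.level w ≤ b := h.mem_below hxb
  have hnd : A.Nodup := h.nodup_below x b
  have hxA : x ∉ A := fun hx => hirr x ((hmem x).1 hx).1
  have f1 := frame_foldl (fun s w => frame_unlink x w s) A
    (State.tick (b + 2 - s.level x + A.length) s)
  have r1 := (h.tick (b + 2 - s.level x + A.length)).foldl_unlink (x := x) hnd hxA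
    (fun w hw => ((hmem w).1 hw).1) (fun w hw => hsymm _ _ ((hmem w).1 hw).1)
  set s₁ := A.foldl (fun r w => State.unlink x w r)
    (State.tick (b + 2 - s.level x + A.length) s) with hs₁
  have hl1 : s₁.level = s.level := f1.level
  have r2 := r1.relabel (x := x) (m := m) (c := c) (t := s₁.time + 1) (by simp [hirr])
    (by
      rw [hl1]
      rintro w ⟨hw, hw', -⟩
      have : ¬ (R x w ∧ s.level w ≤ b) := fun hh => hw' ⟨rfl, (hmem w).2 hh⟩
      grind)
    (by
      rw [hl1]
      rintro w ⟨hw, -, hw'⟩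
      have : ¬ (R x w ∧ s.level w ≤ b) := fun hh => hw' ⟨rfl, (hmem w).2 hh⟩
      grind)
  have r3 := r2.foldl_link (x := x) hnd hxA (by grind) (by grind)
  have f3 := frame_foldl (fun s w => frame_link x w s) A
    { s₁ with
      level := Function.update s₁.level x m
      color := Function.update s₁.color x c
      time := s₁.time + 1 }
  have hmv : State.move x m c s = A.foldl (fun r w => State.link x w r)
    { s₁ with
      level := Function.update s₁.level x m
      color := Function.update s₁.color x c
      time := s₁.time + 1 } := rfl
  rw [hmv]
  refine ⟨r3.congr ?_, ?_, ?_, ?_, ?_, ?_⟩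
  · intro v w
    have := hmem v
    have := hmem w
    grind
  · rw [f3.level]; simp only [hl1]
  · rw [f3.color]; simp only [f1.color]; rfl
  · rw [f3.stamp]; simp only [f1.stamp]; rfl
  · rw [f3.calls]; simp only [f1.calls]; rfl
  · have t1 := f1.time
    have t3 := f3.time
    have : A.length = phi s x b := rfl
    simp only [State.tick] at t1 t3
    omega

end State

end DynColoring

/-! ### Recoloring: cost, target level and palette -/

namespace DynColoring

namespace State

variable {n Δ : ℕ}

/-- The invariant of the data structure for the current graph `G`: the records describe `G`, no
time stamp exceeds the number of recolorings, and a node at level `k` was once seen with `3 ^ k`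
neighbors (when `k = 0`, the bounds say that there are nodes and colors at all). -/
structure Inv (G : SimpleGraph (Fin n)) (s : State n Δ) : Prop where
  rep : Rep G.Adj s
  stamp_le : ∀ v, s.stamp v ≤ s.calls
  pow_le_degree : ∀ v, 3 ^ s.level v ≤ Δ
  pow_le_nodes : ∀ v, 3 ^ s.level v ≤ n

theorem Inv.tick {G : SimpleGraph (Fin n)} {s : State n Δ} (h : Inv G s) (k : ℕ) :
    Inv G (tick k s) := ⟨h.rep.tick k, h.2, h.3, h.4⟩

theorem Inv.init (hn : 2 ≤ n) (hΔ : 0 < Δ) (χ₀ : Fin n → Fin (Δ + 1)) :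
    Inv (⊥ : SimpleGraph (Fin n)) (init χ₀) := by
  refine ⟨⟨?_, ?_, ?_, ?_, ?_, ?_, ?_⟩, ?_, ?_, ?_⟩ <;> simp [State.init, List.nodup_finRange] <;>
    omega

/-- `s'` is `s` after a recoloring of `x` with `c` at level `m`, apart from the records. -/
structure Recolored (x : Fin n) (m : ℕ) (c : Fin (Δ + 1)) (s s' : State n Δ) : Prop where
  level : s'.level = Function.update s.level x m
  color : s'.color = Function.update s.color x c
  stamp : s'.stamp = Function.update s.stamp x (s.calls + 1)
  calls : s'.calls = s.calls + 1

theorem Recolored.inv {G : SimpleGraph (Fin n)} {x : Fin n} {m : ℕ} {c : Fin (Δ + 1)}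
    {s s' : State n Δ} (h : Recolored x m c s s') (hs : Inv G s) (hr : Rep G.Adj s')
    (h1 : 3 ^ m ≤ Δ) (h2 : 3 ^ m ≤ n) : Inv G s' := by
  refine ⟨hr, ?_, ?_, ?_⟩ <;> intro v
  · have := hs.stamp_le v
    rw [h.stamp, h.calls, Function.update_apply]
    grind
  · have := hs.pow_le_degree v
    rw [h.level, Function.update_apply]
    grind
  · have := hs.pow_le_nodes v
    rw [h.level, Function.update_apply]
    grind

theorem Rep.mark {R : Fin n → Fin n → Prop} {s : State n Δ} (h : Rep R s) (x : Fin n) :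
    Rep R (mark x s) := ⟨h.1, h.2, h.3, h.4, h.5, h.6, h.7⟩

theorem length_down_le_phi (s : State n Δ) (x : Fin n) (m : ℕ) :
    (s.down x).length ≤ phi s x m := by
  simp [phi, below]

/-- Every color scanned in vain is that of some down-neighbor, and these colors are distinct. -/
theorem findIdx_free_le {s : State n Δ} {x : Fin n} (h : (s.free x).Nodup) :
    ((s.free x).findIdx fun c => occ s x c = 0) ≤ (s.down x).length := by
  set i := (s.free x).findIdx fun c => occ s x c = 0 with hi
  have hlen : i ≤ (s.free x).length := List.findIdx_le_length
  have hsub : ((s.free x).take i).toFinset ⊆ ((s.down x).map s.color).toFinset := by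
    intro c hc
    rw [List.mem_toFinset, List.mem_take_iff_getElem] at hc
    obtain ⟨j, hj, rfl⟩ := hc
    have hj' : j < i := by omega
    have := List.not_of_lt_findIdx (p := fun c => decide (occ s x c = 0)) (xs := s.free x)
      (i := j) hj'
    simp only [decide_eq_false_iff_not, occ, List.countP_eq_zero] at this
    push Not at this
    obtain ⟨w, hw, hwc⟩ := this
    simp only [decide_eq_true_eq] at hwc
    simp only [List.mem_toFinset, List.mem_map]
    exact ⟨w, hw, hwc⟩
  have hcard := Finset.card_le_card hsub
  rw [List.toFinset_card_of_nodup (h.sublist (List.take_sublist _ _)), List.length_take,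
    min_eq_left hlen] at hcard
  refine hcard.trans ((List.toFinset_card_le _).trans ?_)
  simp

/-- A deterministic recoloring takes time proportional to the bound on `phi` under which it is
chosen. The initial step is the test in `recolor`. -/
theorem detColor_spec {G : SimpleGraph (Fin n)} {s : State n Δ} (h : Inv G s) (x : Fin n)
    (hphi : phi s x (s.level x) < 3 ^ (s.level x + 1)) :
    Inv G (detColor x (State.tick 1 s)) ∧
      (∃ c, Recolored x 0 c s (detColor x (State.tick 1 s))) ∧
      (detColor x (State.tick 1 s)).time ≤ s.time + 100 * 3 ^ s.level x := by
  set i := (s.free x).findIdx fun c => occ s x c = 0 with hi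
  have hi' : i ≤ (s.down x).length := findIdx_free_le (h.rep.free_nodup x)
  set c := ((s.free x)[i]?).getD (s.color x)
  have hd : detColor x (State.tick 1 s) = State.mark x (State.move x 0 c
    (State.tick (2 * (s.down x).length + (i + 1)) (State.tick 1 s))) := rfl
  obtain ⟨h1, h2, h3, h4, h5, h6⟩ := ((h.rep.tick 1).tick
    (2 * (s.down x).length + (i + 1))).move (fun v => G.irrefl) (fun _ _ hvw => hvw.symm) x 0 c
  have hrec : Recolored x 0 c s (detColor x (State.tick 1 s)) := by
    rw [hd]
    constructor
    · exact h2
    · exact h3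
    · simp only [State.mark, h4, h5]; rfl
    · simp only [State.mark, h5]; rfl
  have hpow := h.pow_le_degree x
  have hpow' := h.pow_le_nodes x
  have hpos : 0 < 3 ^ s.level x := by positivity
  refine ⟨hrec.inv h (by rw [hd]; exact h1.mark x) (by simp; omega) (by simp; omega),
    ⟨c, hrec⟩, ?_⟩
  rw [hd]
  simp only [State.mark]
  have hdl := length_down_le_phi s x (s.level x)
  have hl : (State.tick (2 * (s.down x).length + (i + 1)) (State.tick 1 s)).level = s.level := rfl
  have hp : ∀ k, phi (State.tick (2 * (s.down x).length + (i + 1)) (State.tick 1 s)) x k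
    = phi s x k := fun _ => rfl
  rw [hl, hp] at h6
  have ht : (State.tick (2 * (s.down x).length + (i + 1)) (State.tick 1 s)).time =
    s.time + 1 + (2 * (s.down x).length + (i + 1)) := rfl
  rw [ht, Nat.max_zero] at h6
  rw [pow_succ] at hphi
  omega

theorem phi_le {R : Fin n → Fin n → Prop} {s : State n Δ} (h : Rep R s)
    (hirr : ∀ v, ¬ R v v) {x : Fin n} {m : ℕ} (hm : s.level x ≤ m) : phi s x m ≤ n - 1 := by
  rw [h.phi_eq hm]
  calc {w | R x w ∧ s.level w ≤ m}.ncard ≤ ({x}ᶜ : Set (Fin n)).ncard := by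
        apply Set.ncard_le_ncard _ (Set.toFinite _)
        rintro w ⟨hw, -⟩ rfl
        exact hirr _ hw
    _ = n - 1 := by
        rw [Set.ncard_compl, Set.ncard_singleton, Nat.card_eq_fintype_card, Fintype.card_fin]

/-- The search for the target level succeeds, since all neighbors are below the top level. -/
theorem targetLevel_spec {G : SimpleGraph (Fin n)} {s : State n Δ} (h : Rep G.Adj s) (x : Fin n)
    (hphi : ¬ phi s x (s.level x) < 3 ^ (s.level x + 1)) :
    s.level x < targetLevel s x ∧ phi s x (targetLevel s x) < 3 ^ (targetLevel s x + 1) ∧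
      3 ^ targetLevel s x ≤ phi s x (targetLevel s x - 1) := by
  have hirr : ∀ v, ¬ G.Adj v v := fun v => G.irrefl
  have htop : n - 1 ≤ 3 ^ topLevel n := Nat.le_pow_clog (by norm_num) _
  have hlt : s.level x < topLevel n := by
    by_contra hge
    push Not at hge
    apply hphi
    calc phi s x (s.level x) ≤ n - 1 := phi_le h hirr le_rfl
      _ ≤ 3 ^ topLevel n := htop
      _ < 3 ^ (s.level x + 1) := Nat.pow_lt_pow_right (by norm_num) (by omega)
  have hptop : phi s x (topLevel n) < 3 ^ (topLevel n + 1) :=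
    ((phi_le h hirr hlt.le).trans htop).trans_lt
      (Nat.pow_lt_pow_right (by norm_num) (by omega))
  obtain ⟨m, hm⟩ : ∃ m, (List.range' (s.level x + 1) (topLevel n - s.level x)).find?
      (fun m => phi s x m < 3 ^ (m + 1)) = some m := by
    rw [← Option.isSome_iff_exists, List.find?_isSome]
    refine ⟨topLevel n, ?_, by simpa using hptop⟩
    rw [List.mem_range'_1]
    omega
  have hT : targetLevel s x = m := by rw [targetLevel, hm]; rfl
  rw [List.find?_range'_eq_some] at hm
  obtain ⟨h1, h2, h3⟩ := hm
  rw [List.mem_range'_1] at h2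
  rw [hT]
  refine ⟨by omega, by simpa using h1, ?_⟩
  obtain ⟨k, rfl⟩ : ∃ k, m = k + 1 := ⟨m - 1, by omega⟩
  rw [Nat.add_sub_cancel]
  -- Level `m - 1` was tested: by `recolor` if it is the old level, else by the search.
  by_cases hk : k = s.level x
  · subst hk
    omega
  · have := h3 k (by omega) (by omega)
    simpa using this

/-- The passage over `down x` removes only colors of two or more down-neighbors. -/
theorem subset_palette {s : State n Δ} {x : Fin n} (h : (s.free x).Nodup) {c : Fin (Δ + 1)}
    (hc : c ∈ s.free x) (ho : occ s x c ≤ 1) : c ∈ palette s x := by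
  unfold palette
  have key : ∀ (A : List (Fin n)) (l : List (Fin (Δ + 1))), l.Nodup → c ∈ l →
      c ∈ A.foldl (fun l w => if 2 ≤ occ s x (s.color w) ∧ s.color w ∈ l
        then swapRemove l (s.color w) else l) l := by
    intro A
    induction A with
    | nil => intro l _ hc; exact hc
    | cons w A ih =>
      intro l hl hc
      rw [List.foldl_cons]
      split_ifs with hw
      · refine ih _ (nodup_swapRemove hl) ?_
        rw [mem_swapRemove hl hw.2]
        refine ⟨hc, ?_⟩
        rintro rfl
        omega
      · exact ih _ hl hc
  exact key _ _ h hc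

/-- At most `Δ` colors are lost to up-neighbors, one each, and to pairs of down-neighbors. -/
theorem length_down_le_palette {R : Fin n → Fin n → Prop} {s : State n Δ} (h : Rep R s)
    {x : Fin n} (hdeg : {w | R x w}.ncard ≤ Δ) :
    (s.down x).length ≤ 2 * (palette s x).toFinset.card := by
  classical
  set U : Finset (Fin n) := Finset.univ.filter fun w => R x w ∧ s.level x ≤ s.level w with hU
  have hdegsum : (s.down x).length + U.card ≤ Δ := by
    refine le_trans (le_of_eq ?_) hdeg
    rw [h.length_down, ← Set.ncard_coe_finset, ← Set.ncard_union_eq]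
    · congr 1
      ext w
      simp [hU]
      grind
    · rw [Set.disjoint_left]
      intro w
      simp [hU]
      grind
  set D : Finset (Fin (Δ + 1)) := Finset.univ.filter fun c => 2 ≤ occ s x c with hD
  have hDcard : 2 * D.card ≤ (s.down x).length := by
    have hsum : ∑ c : Fin (Δ + 1), occ s x c = (s.down x).length := by
      have := Finset.card_eq_sum_card_fiberwise (f := s.color) (s := (s.down x).toFinset)
        (t := Finset.univ) (by simp)
      rw [List.toFinset_card_of_nodup (h.down_nodup x)] at this
      rw [this]
      refine Finset.sum_congr rfl fun c _ => ?_
      rw [occ, List.countP_eq_length_filter,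
        ← List.toFinset_card_of_nodup ((h.down_nodup x).filter _), List.toFinset_filter]
      simp
    calc 2 * D.card = ∑ c ∈ D, 2 := by rw [Finset.sum_const, smul_eq_mul, mul_comm]
      _ ≤ ∑ c ∈ D, occ s x c := Finset.sum_le_sum fun c hc => by simpa [hD] using hc
      _ ≤ ∑ c, occ s x c := Finset.sum_le_sum_of_subset (Finset.subset_univ _)
      _ = _ := hsum
  have hcover : (Finset.univ : Finset (Fin (Δ + 1))) ⊆
      (palette s x).toFinset ∪ (U.image s.color ∪ D) := by
    intro c _
    by_cases hcD : c ∈ D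
    · simp [hcD]
    · by_cases hcU : c ∈ U.image s.color
      · simp [hcU]
      · have hfree : c ∈ s.free x := by
          rw [h.mem_free, h.mu_eq, Set.ncard_eq_zero (Set.toFinite _)]
          ext w
          simp only [Set.mem_ofPred_eq, Set.mem_empty_iff_false, iff_false]
          rintro ⟨h1, h2, h3⟩
          exact hcU (Finset.mem_image.2 ⟨w, by simp [hU, h1, h2], h3⟩)
        have hocc : occ s x c ≤ 1 := by
          have : ¬ 2 ≤ occ s x c := by simpa [hD] using hcD
          omega
        simp [subset_palette (h.free_nodup x) hfree hocc]
  have := Finset.card_le_card hcover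
  rw [Finset.card_univ, Fintype.card_fin] at this
  have h1 := Finset.card_union_le (palette s x).toFinset (U.image s.color ∪ D)
  have h2 := Finset.card_union_le (U.image s.color) D
  have h3 : (U.image s.color).card ≤ U.card := Finset.card_image_le
  omega

/-- The target level `m` is minimal, so `x` gets at least `3 ^ m` down-neighbors there, and fewer
than `3 ^ (m + 1)` neighbors up to that level. -/
theorem raise_spec {G : SimpleGraph (Fin n)} {s : State n Δ} (h : Rep G.Adj s) (x : Fin n)
    (hphi : ¬ phi s x (s.level x) < 3 ^ (s.level x + 1)) :
    ∃ m, 3 ^ m ≤ ((raise x s).down x).length ∧ phi (raise x s) x m < 3 ^ (m + 1) ∧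
      Rep G.Adj (raise x s) ∧ (raise x s).level = Function.update s.level x m ∧
      (raise x s).color = s.color ∧ (raise x s).stamp = s.stamp ∧ (raise x s).calls = s.calls ∧
      (raise x s).time ≤ s.time + 33 * 3 ^ m := by
  have hirr : ∀ v, ¬ G.Adj v v := fun v => G.irrefl
  obtain ⟨t1, t2, t3⟩ := targetLevel_spec h x hphi
  set m := targetLevel s x with hm
  obtain ⟨h1, h2, h3, h4, h5, h6⟩ := (h.tick (m + 1 - s.level x)).move hirr
    (fun _ _ hvw => hvw.symm) x m (s.color x)
  have hr : raise x s = State.move x m (s.color x) (State.tick (m + 1 - s.level x) s) := rfl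
  rw [← hr] at h1 h2 h3 h4 h5 h6
  have hp : ∀ k, phi (State.tick (m + 1 - s.level x) s) x k = phi s x k := fun _ => rfl
  have hl : (State.tick (m + 1 - s.level x) s).level = s.level := rfl
  have hc : (State.tick (m + 1 - s.level x) s).color = s.color := rfl
  rw [hl] at h2 h6
  rw [hp, max_eq_right t1.le] at h6
  refine ⟨m, ?_, ?_, h1, h2, by rw [h3, hc, Function.update_eq_self], h4, h5, ?_⟩
  · rw [h1.length_down]
    refine t3.trans (le_of_eq ?_)
    rw [h.phi_eq (by omega)]
    congr 1
    ext w
    have := hirr x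
    simp only [Set.mem_ofPred_eq, h2, Function.update_apply]
    grind
  · refine lt_of_le_of_lt (le_of_eq ?_) t2
    rw [h.phi_eq t1.le, h1.phi_eq (by simp [h2])]
    congr 1
    ext w
    have := hirr x
    simp only [Set.mem_ofPred_eq, h2, Function.update_apply]
    grind
  · have hmlt : m < 3 ^ m := Nat.lt_pow_self (by norm_num)
    rw [pow_succ] at t2
    simp only [State.tick] at h6
    omega

/-- Together with `raise`, the random recoloring of `x` in the state `s` is a recoloring at level
`m`. The returned node was at a lower level. -/
theorem finish_spec {G : SimpleGraph (Fin n)} {s r : State n Δ} {x : Fin n} {m : ℕ}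
    (hr : Rep G.Adj r) (hphi : phi r x m < 3 ^ (m + 1))
    (hl : r.level = Function.update s.level x m) (hc : r.color = s.color)
    (hst : r.stamp = s.stamp) (hca : r.calls = s.calls) (c : Fin (Δ + 1)) :
    Rep G.Adj (finish x r c).2 ∧ Recolored x m c s (finish x r c).2 ∧
      (finish x r c).2.time ≤ r.time + 47 * 3 ^ m ∧
      ∀ y ∈ (finish x r c).1, y ≠ x ∧ s.level y < m := by
  have hlx : r.level x = m := by simp [hl]
  obtain ⟨h1, h2, h3, h4, h5, h6⟩ := (hr.tick (5 * (r.down x).length + 1)).move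
    (fun v => G.irrefl) (fun _ _ hvw => hvw.symm) x m c
  have hf : (finish x r c).2 = State.mark x
      (State.move x m c (State.tick (5 * (r.down x).length + 1) r)) := by
    rw [← hlx]; rfl
  refine ⟨?_, ?_, ?_, ?_⟩
  · rw [hf]; exact h1.mark x
  · rw [hf]
    constructor
    · simp only [State.mark, h2]
      change Function.update r.level x m = _
      simp [hl]
    · simp only [State.mark, h3]
      change Function.update r.color x c = _
      rw [hc]
    · simp only [State.mark, h4, h5]
      change Function.update r.stamp x (r.calls + 1) = _
      rw [hst, hca]
    · simp only [State.mark, h5]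
      change r.calls + 1 = _
      rw [hca]
  · rw [hf]
    have hl' : (State.tick (5 * (r.down x).length + 1) r).level = r.level := rfl
    have hp : ∀ k, phi (State.tick (5 * (r.down x).length + 1) r) x k = phi r x k := fun _ => rfl
    rw [hl', hlx, hp, max_self] at h6
    simp only [State.mark, State.tick] at h6 ⊢
    have := length_down_le_phi r x m
    rw [pow_succ] at hphi
    have : 0 < 3 ^ m := by positivity
    omega
  · intro y hy
    have hy' : y ∈ r.down x := List.mem_of_find?_eq_some hy
    rw [hr.mem_down, hl] at hy'
    have hyx : y ≠ x := by
      rintro rfl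
      exact G.irrefl hy'.1
    refine ⟨hyx, ?_⟩
    simpa [Function.update_apply, hyx] using hy'.2

end State

end DynColoring

/-! ### The potential -/

namespace DynColoring

variable {n Δ : ℕ}

/-- The other endpoint, if the update inserts an edge at `v`. -/
def Update.partner (v : Fin n) : Update n → Option (Fin n)
  | .insert a b => if v = a then some b else if v = b then some a else none
  | .delete _ _ => none

/-- How far the next insertion at `v` of an edge to some `w` with `P w` lies ahead: `18` for each
insertion at `v` up to that one, cut off at `cap`. Without such an insertion it is `cap`. -/
def reserve (cap : ℕ) (P : Fin n → Prop) [DecidablePred P] (v : Fin n) : List (Update n) → ℕ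
  | [] => cap
  | e :: es =>
    match e.partner v with
    | none => reserve cap P v es
    | some w => if P w then min cap 18 else min cap (18 + reserve cap P v es)

section reserve

variable (cap : ℕ) (P : Fin n → Prop) [DecidablePred P] (v : Fin n)

theorem reserve_le (us : List (Update n)) : reserve cap P v us ≤ cap := by
  induction us with
  | nil => exact le_rfl
  | cons e es ih =>
    rw [reserve]
    split
    · exact ih
    · split_ifs <;> exact min_le_left _ _

theorem reserve_mono {P' : Fin n → Prop} [DecidablePred P'] (h : ∀ w, P' w → P w)
    (us : List (Update n)) : reserve cap P v us ≤ reserve cap P' v us := by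
  induction us with
  | nil => exact le_rfl
  | cons e es ih =>
    rw [reserve, reserve]
    cases e.partner v with
    | none => exact ih
    | some w =>
      have := h w
      have := reserve_le cap P' v es
      simp only
      split_ifs <;> grind

theorem reserve_cons_of_none {e : Update n} (he : e.partner v = none) (es : List (Update n)) :
    reserve cap P v (e :: es) = reserve cap P v es := by
  rw [reserve, he]

theorem reserve_cons_of_some {e : Update n} {w : Fin n} (he : e.partner v = some w) (hw : P w)
    (es : List (Update n)) : reserve cap P v (e :: es) ≤ 18 := by
  rw [reserve, he]
  simp [hw]

theorem reserve_cons_le (e : Update n) (es : List (Update n)) :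
    reserve cap P v (e :: es) ≤ 18 + reserve cap P v es := by
  rw [reserve]
  cases e.partner v with
  | none => simp
  | some w =>
    simp only
    split_ifs <;> omega

end reserve

/-- Only the colors of the next few partners of `v` can make its reserve small. -/
theorem card_filter_reserve_lt (cap : ℕ) (col : Fin n → Fin (Δ + 1)) (v : Fin n)
    (us : List (Update n)) (b : ℕ) (hb : b ≤ cap) :
    18 * (Finset.univ.filter fun c : Fin (Δ + 1) =>
      reserve cap (fun w => col w = c) v us < b).card ≤ b := by
  induction us generalizing b with
  | nil =>
    have : ∀ c : Fin (Δ + 1), ¬ reserve cap (fun w => col w = c) v [] < b := by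
      intro c
      rw [reserve]; omega
    simp [this]
  | cons e es ih =>
    cases he : e.partner v with
    | none =>
      simp only [reserve_cons_of_none cap _ v he]
      exact ih b hb
    | some w =>
      -- The first insertion at `v` adds its partner's color only if it is among the first `b / 18`.
      by_cases h18 : b ≤ 18
      · have : ∀ c : Fin (Δ + 1), ¬ reserve cap (fun w => col w = c) v (e :: es) < b := by
          intro c
          rw [reserve, he]
          simp only
          split_ifs <;> omega
        simp [this]
      · have hsub : (Finset.univ.filter fun c : Fin (Δ + 1) =>
            reserve cap (fun w => col w = c) v (e :: es) < b) ⊆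
            insert (col w) (Finset.univ.filter fun c : Fin (Δ + 1) =>
              reserve cap (fun w => col w = c) v es < b - 18) := by
          intro c hc
          simp only [Finset.mem_filter, Finset.mem_univ, true_and, Finset.mem_insert] at hc ⊢
          rw [reserve, he] at hc
          simp only at hc
          split_ifs at hc with hw
          · exact Or.inl hw.symm
          · right; omega
        have h1 := Finset.card_le_card hsub
        have h2 := Finset.card_insert_le (col w) (Finset.univ.filter fun c : Fin (Δ + 1) =>
              reserve cap (fun w => col w = c) v es < b - 18)
        have h3 := ih (b - 18) (by omega)
        omega

namespace State

/-- An insertion of the edge `vw` in the present state would make `v` the node to be recolored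
(up to the choice among two nodes that were never recolored). -/
def Conflict (s : State n Δ) (v w : Fin n) : Prop :=
  w ≠ v ∧ s.color w = s.color v ∧ s.stamp w ≤ s.stamp v

instance (s : State n Δ) (v : Fin n) : DecidablePred (s.Conflict v) :=
  fun _ => inferInstanceAs (Decidable (_ ∧ _))

/-- The potential of `v` when the updates `us` are still to come. Up to a constant, it is the cost
of the current epoch of `v` with the opposite sign when an insertion is about to end the epoch, and
it rises to five times that cost when no such end is in sight. -/
def pot (us : List (Update n)) (s : State n Δ) (v : Fin n) : ℝ :=
  600 * reserve (3 ^ s.level v) (s.Conflict v) v us - 100 * 3 ^ s.level v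

theorem neg_le_pot (us : List (Update n)) (s : State n Δ) (v : Fin n) :
    -(100 * 3 ^ s.level v) ≤ pot us s v := by
  have : (0 : ℝ) ≤ reserve (3 ^ s.level v) (s.Conflict v) v us := Nat.cast_nonneg _
  unfold pot
  linarith

theorem pot_le (us : List (Update n)) (s : State n Δ) (v : Fin n) :
    pot us s v ≤ 500 * 3 ^ s.level v := by
  have : (reserve (3 ^ s.level v) (s.Conflict v) v us : ℝ) ≤ 3 ^ s.level v := by
    exact_mod_cast reserve_le _ _ _ _
  unfold pot
  linarith

/-- The amortized time between two calls of `recolor` outside of the loop. -/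
def idle (us : List (Update n)) (s : State n Δ) : ℝ :=
  s.time - ∑ v, pot us s v

/-- The amortized time before a call of `recolor` for `x`: the potential of `x` is given up. -/
def pending (us : List (Update n)) (s : State n Δ) (x : Fin n) : ℝ :=
  s.time + 100 * 3 ^ s.level x - ∑ v ∈ Finset.univ.erase x, pot us s v

theorem idle_eq (us : List (Update n)) (s : State n Δ) (x : Fin n) :
    idle us s = s.time - pot us s x - ∑ v ∈ Finset.univ.erase x, pot us s v := by
  rw [idle, ← Finset.add_sum_erase _ _ (Finset.mem_univ x)]
  ring

theorem idle_le_pending (us : List (Update n)) (s : State n Δ) (x : Fin n) :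
    idle us s ≤ pending us s x := by
  have := neg_le_pot us s x
  rw [idle_eq us s x, pending]
  linarith

/-- Recoloring `x` does not bring the end of the epoch of another node nearer, because `x` then has
the latest time stamp. -/
theorem Recolored.pot_le {G : SimpleGraph (Fin n)} {x : Fin n} {m : ℕ} {c : Fin (Δ + 1)}
    {s s' : State n Δ} (h : Recolored x m c s s') (hs : Inv G s) (us : List (Update n)) {v : Fin n}
    (hv : v ≠ x) : pot us s v ≤ pot us s' v := by
  have hl : s'.level v = s.level v := by simp [h.level, hv]
  have hr : reserve (3 ^ s.level v) (s.Conflict v) v us ≤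
      reserve (3 ^ s.level v) (s'.Conflict v) v us := by
    refine reserve_mono _ _ _ ?_ _
    intro w
    have := hs.stamp_le v
    simp only [Conflict, h.color, h.stamp, Function.update_apply]
    grind
  unfold pot
  rw [hl]
  have : (reserve (3 ^ s.level v) (s.Conflict v) v us : ℝ) ≤
      reserve (3 ^ s.level v) (s'.Conflict v) v us := by exact_mod_cast hr
  linarith

/-- The potential of the returned node `y` is given up, and the end of its epoch has to be paid
for; as `y` lies below level `m`, both are at most a third of what they would be at level `m`. -/
theorem Recolored.pending_le {G : SimpleGraph (Fin n)} {x y : Fin n} {m : ℕ} {c : Fin (Δ + 1)}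
    {s s' : State n Δ} (h : Recolored x m c s s') (hs : Inv G s) (us : List (Update n))
    (ht : (s'.time : ℝ) ≤ s.time + 81 * 3 ^ m) (hyx : y ≠ x) (hy : s.level y < m) :
    pending us s' y ≤ pending us s x + 281 * 3 ^ m - pot us s' x := by
  have hsum : ∑ v ∈ (Finset.univ.erase x).erase y, pot us s v ≤
      ∑ v ∈ (Finset.univ.erase x).erase y, pot us s' v :=
    Finset.sum_le_sum fun v hv => h.pot_le hs us (by simp at hv; exact hv.2)
  have h1 := Finset.add_sum_erase (Finset.univ.erase x) (pot us s) (a := y) (by simp [hyx])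
  have h2 := Finset.add_sum_erase (Finset.univ.erase y) (pot us s') (a := x) (by simp [hyx.symm])
  rw [Finset.erase_right_comm] at h2
  have hly : s'.level y = s.level y := by simp [h.level, hyx]
  have h3 := State.pot_le us s y
  obtain ⟨k, rfl⟩ : ∃ k, m = k + 1 := ⟨m - 1, by omega⟩
  have hk : (3 : ℝ) ^ s.level y ≤ 3 ^ k := pow_le_pow_right₀ (by norm_num) (by omega)
  have hx : (0 : ℝ) < 3 ^ s.level x := by positivity
  rw [pending, pending, hly]
  rw [pow_succ] at ht ⊢
  linarith

theorem Recolored.idle_le {G : SimpleGraph (Fin n)} {x : Fin n} {m : ℕ} {c : Fin (Δ + 1)}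
    {s s' : State n Δ} (h : Recolored x m c s s') (hs : Inv G s) (us : List (Update n)) :
    idle us s' ≤ pending us s x + (s'.time - s.time - 100 * 3 ^ s.level x) - pot us s' x := by
  have hsum : ∑ v ∈ Finset.univ.erase x, pot us s v ≤ ∑ v ∈ Finset.univ.erase x, pot us s' v :=
    Finset.sum_le_sum fun v hv => h.pot_le hs us (by simpa using hv)
  rw [idle_eq us s' x, pending]
  linarith

/-- Right after the recoloring of `x`, all insertions at `x` of edges to nodes of its color are
conflicts for `x`. -/
theorem Recolored.reserve_le {x : Fin n} {m : ℕ} {c : Fin (Δ + 1)}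
    {s s' : State n Δ} (h : Recolored x m c s s') (us : List (Update n)) :
    reserve (3 ^ m) (fun w => s.color w = c) x us ≤
      reserve (3 ^ s'.level x) (s'.Conflict x) x us := by
  have hl : s'.level x = m := by simp [h.level]
  rw [hl]
  refine reserve_mono _ _ _ ?_ _
  rintro w ⟨hwx, hw, -⟩
  simpa [h.color, hwx] using hw

end State

end DynColoring

/-! ### Exponential moments of the amortized time -/

open scoped ENNReal

namespace DynColoring

/-- The mean of a nonnegative function. -/
noncomputable def mean {α : Type*} (p : PMF α) (f : α → ℝ≥0∞) : ℝ≥0∞ := ∑' a, p a * f a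

section mean

variable {α β : Type*}

theorem mean_mono (p : PMF α) {f g : α → ℝ≥0∞} (h : ∀ a, f a ≤ g a) : mean p f ≤ mean p g :=
  ENNReal.tsum_le_tsum fun a => mul_le_mul_right (h a) _

theorem mean_mul_const (p : PMF α) (f : α → ℝ≥0∞) (c : ℝ≥0∞) :
    mean p (fun a => f a * c) = mean p f * c := by
  simp only [mean, ← ENNReal.tsum_mul_right, mul_assoc]

theorem mean_pure (a : α) (f : α → ℝ≥0∞) : mean (PMF.pure a) f = f a := by
  rw [mean, tsum_eq_single a]
  · simp
  · intro b hb
    simp [PMF.pure_apply, hb]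

theorem mean_bind (p : PMF α) (q : α → PMF β) (f : β → ℝ≥0∞) :
    mean (p.bind q) f = mean p fun a => mean (q a) f := by
  simp only [mean, PMF.bind_apply, ← ENNReal.tsum_mul_right, ← ENNReal.tsum_mul_left]
  rw [ENNReal.tsum_comm]
  simp only [mul_assoc]

theorem mean_map (p : PMF α) (g : α → β) (f : β → ℝ≥0∞) :
    mean (p.map g) f = mean p fun a => f (g a) := by
  rw [PMF.map, mean_bind]
  simp only [Function.comp_apply, mean_pure]

/-- Markov's inequality. -/
theorem toMeasure_mul_le_mean [MeasurableSpace α] (p : PMF α) (f : α → ℝ≥0∞) {S : Set α}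
    (hS : MeasurableSet S) {c : ℝ≥0∞} (h : ∀ a ∈ S, c ≤ f a) : p.toMeasure S * c ≤ mean p f := by
  rw [PMF.toMeasure_apply _ hS, ← ENNReal.tsum_mul_right]
  refine ENNReal.tsum_le_tsum fun a => ?_
  by_cases ha : a ∈ S
  · rw [Set.indicator_of_mem ha]
    exact mul_le_mul_right (h a ha) _
  · rw [Set.indicator_of_notMem ha]
    simp

theorem mean_uniformOfFinset_le {P : Finset α} (hP : P.Nonempty) {f : α → ℝ≥0∞} {g : α → ℝ}
    {W : ℝ} (hg : ∀ c ∈ P, 0 ≤ g c) (hf : ∀ c ∈ P, f c ≤ ENNReal.ofReal (g c))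
    (hW : ∑ c ∈ P, g c ≤ P.card * W) :
    mean (PMF.uniformOfFinset P hP) f ≤ ENNReal.ofReal W := by
  have hc : (P.card : ℝ≥0∞) ≠ 0 := by simpa using hP.ne_empty
  have h1 : mean (PMF.uniformOfFinset P hP) f = (P.card : ℝ≥0∞)⁻¹ * ∑ c ∈ P, f c := by
    rw [mean, tsum_eq_sum (s := P), Finset.mul_sum]
    · refine Finset.sum_congr rfl fun c hcP => ?_
      rw [PMF.uniformOfFinset_apply_of_mem hP hcP]
    · intro c hcP
      rw [PMF.uniformOfFinset_apply_of_notMem hP hcP, zero_mul]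
  rw [h1]
  calc (P.card : ℝ≥0∞)⁻¹ * ∑ c ∈ P, f c
      ≤ (P.card : ℝ≥0∞)⁻¹ * ∑ c ∈ P, ENNReal.ofReal (g c) :=
        mul_le_mul_right (Finset.sum_le_sum hf) _
    _ = (P.card : ℝ≥0∞)⁻¹ * ENNReal.ofReal (∑ c ∈ P, g c) := by
        rw [ENNReal.ofReal_sum_of_nonneg hg]
    _ ≤ (P.card : ℝ≥0∞)⁻¹ * ENNReal.ofReal (P.card * W) :=
        mul_le_mul_right (ENNReal.ofReal_le_ofReal hW) _
    _ = ENNReal.ofReal W := by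
        rw [ENNReal.ofReal_mul (Nat.cast_nonneg _), ENNReal.ofReal_natCast, ← mul_assoc,
          ENNReal.inv_mul_cancel hc (ENNReal.natCast_ne_top _), one_mul]

end mean

/-- A gain with probability at least `8 / 9` outweighs a loss twice as large otherwise. -/
theorem sum_exp_le {α : Type*} [DecidableEq α] (P B : Finset α) (hB : 9 * (P ∩ B).card ≤ P.card)
    {y : ℝ} (h0 : 0 ≤ y) (h1 : y ≤ 1 / 2) :
    ∑ c ∈ P, Real.exp (if c ∈ B then 2 * y else -y) ≤ P.card := by
  have e1 : Real.exp (2 * y) ≤ 1 + 4 * y := by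
    have := Real.abs_exp_sub_one_le (x := 2 * y) (by rw [abs_of_nonneg] <;> linarith)
    rw [abs_of_nonneg (by linarith : 0 ≤ 2 * y)] at this
    have := (abs_le.1 this).2
    linarith
  have e2 : Real.exp (-y) ≤ 1 - y / 2 := by
    rw [Real.exp_neg]
    have h := Real.add_one_le_exp y
    have hpos : (0 : ℝ) < y + 1 := by linarith
    calc (Real.exp y)⁻¹ ≤ (y + 1)⁻¹ := inv_anti₀ hpos h
      _ ≤ 1 - y / 2 := by
        rw [inv_le_iff_one_le_mul₀ hpos]
        nlinarith
  have hB' : (9 : ℝ) * (P ∩ B).card ≤ P.card := by exact_mod_cast hB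
  calc ∑ c ∈ P, Real.exp (if c ∈ B then 2 * y else -y)
      ≤ ∑ c ∈ P, ((1 - y / 2) + if c ∈ B then 9 / 2 * y else 0) := by
        refine Finset.sum_le_sum fun c _ => ?_
        split_ifs <;> linarith
    _ = P.card * (1 - y / 2) + (P ∩ B).card * (9 / 2 * y) := by
        rw [Finset.sum_add_distrib, Finset.sum_const, nsmul_eq_mul, Finset.sum_ite_mem,
          Finset.sum_const, nsmul_eq_mul]
    _ ≤ P.card := by nlinarith

namespace State

variable {n Δ : ℕ}

open Classical in
/-- The exponential weight of an amortized time `F`, infinite where the invariant fails, so that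
a bound on its mean implies the invariant almost surely. -/
noncomputable def weight (G : SimpleGraph (Fin n)) (θ : ℝ) (F : State n Δ → ℝ)
    (s : State n Δ) : ℝ≥0∞ :=
  if Inv G s then ENNReal.ofReal (Real.exp (θ * F s)) else ⊤

theorem weight_of_inv {G : SimpleGraph (Fin n)} {s : State n Δ} (h : Inv G s) (θ : ℝ)
    (F : State n Δ → ℝ) : weight G θ F s = ENNReal.ofReal (Real.exp (θ * F s)) := if_pos h

theorem weight_of_not_inv {G : SimpleGraph (Fin n)} {s : State n Δ} (h : ¬ Inv G s) (θ : ℝ)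
    (F : State n Δ → ℝ) : weight G θ F s = ⊤ := if_neg h

theorem weight_le_of_inv {G : SimpleGraph (Fin n)} {s : State n Δ} (h : Inv G s) {θ : ℝ}
    (hθ : 0 ≤ θ) {F : State n Δ → ℝ} {b : ℝ} (hF : F s ≤ b) :
    weight G θ F s ≤ ENNReal.ofReal (Real.exp (θ * b)) := by
  rw [weight_of_inv h]
  exact ENNReal.ofReal_le_ofReal (Real.exp_le_exp.2 (mul_le_mul_of_nonneg_left hF hθ))

/-- The weight after a call of `recolor`, with an allowance for the deterministic recoloring that
may end the loop. -/
noncomputable def weightAfter (G : SimpleGraph (Fin n)) (θ : ℝ) (us : List (Update n))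
    (p : Option (Fin n) × State n Δ) : ℝ≥0∞ :=
  match p.1 with
  | none => weight G θ (idle us) p.2
  | some y => weight G θ (fun s => pending us s y + 100) p.2

/-- A random recoloring at level `m` costs `O(3 ^ m)` and begins an epoch whose potential pays for
this, unless the drawn color is in the small set of colors with an early conflict. -/
theorem mean_randColor_le {G : SimpleGraph (Fin n)} (hdeg : ∀ v, (G.neighborSet v).ncard ≤ Δ)
    {s : State n Δ} (h : Inv G s) {θ : ℝ} (hθ : 0 ≤ θ) (hθ' : θ * (400 * n) ≤ 1)
    (us : List (Update n)) (x : Fin n) (hphi : ¬ phi s x (s.level x) < 3 ^ (s.level x + 1)) :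
    mean (randColor x (State.tick 1 s)) (weightAfter G θ us) ≤
      ENNReal.ofReal (Real.exp (θ * (pending us s x + 100))) := by
  obtain ⟨m, hm, hphi', hrep, hl, hc, hst, hca, ht⟩ := raise_spec (h.rep.tick 1) x hphi
  set r := raise x (State.tick 1 s) with hr
  have hpal : 3 ^ m ≤ 2 * (palette r x).toFinset.card :=
    hm.trans (length_down_le_palette hrep (hdeg x))
  have hne : (palette r x).toFinset.Nonempty := by
    rw [← Finset.card_pos]
    have : 0 < 3 ^ m := by positivity
    omega
  have hmΔ : 3 ^ m ≤ Δ := by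
    refine hm.trans (le_trans ?_ (hdeg x))
    rw [hrep.length_down]
    exact Set.ncard_le_ncard (fun w hw => hw.1) (Set.toFinite _)
  have hmn : 3 ^ m ≤ n := by
    refine hm.trans ?_
    rw [hrep.length_down]
    exact (Set.ncard_le_card _).trans (by simp)
  have hmn' : (3 : ℝ) ^ m ≤ n := by exact_mod_cast hmn
  set B : Finset (Fin (Δ + 1)) := Finset.univ.filter fun c =>
    reserve (3 ^ m) (fun w => s.color w = c) x us < 3 ^ m with hB
  have hBcard : 18 * B.card ≤ 3 ^ m := card_filter_reserve_lt (3 ^ m) s.color x us (3 ^ m) le_rfl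
  -- The amortized time falls by `200 * 3 ^ m` or rises by at most `400 * 3 ^ m`.
  set y := θ * (200 * 3 ^ m) with hy
  have hy0 : 0 ≤ y := by positivity
  have hy1 : y ≤ 1 / 2 := by
    have : y ≤ θ * (200 * n) := by
      rw [hy]; gcongr
    linarith
  set p := pending us s x + 100 with hp
  have hrand : randColor x (State.tick 1 s) =
      (PMF.uniformOfFinset (palette r x).toFinset hne).map (finish x r) := by
    rw [randColor]
    exact dif_pos hne
  rw [hrand, mean_map]
  refine mean_uniformOfFinset_le hne
    (g := fun c => Real.exp (θ * p) * Real.exp (if c ∈ B then 2 * y else -y))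
    (fun c _ => by positivity) ?_ ?_
  · intro c _
    obtain ⟨f1, f2, f3, f4⟩ := finish_spec (s := s) hrep hphi' hl hc hst hca c
    have hinv := f2.inv h f1 hmΔ hmn
    set s' := (finish x r c).2 with hs'
    have htime : s'.time ≤ s.time + 81 * 3 ^ m := by
      have h1 : (State.tick 1 s).time = s.time + 1 := rfl
      have : 0 < 3 ^ m := by positivity
      omega
    have htime' : (s'.time : ℝ) ≤ s.time + 81 * 3 ^ m := by exact_mod_cast htime
    have hpos : (0 : ℝ) < 3 ^ m := by positivity
    have hlx : s'.level x = m := by simp [f2.level]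
    have hpot : 281 * 3 ^ m - pot us s' x ≤ if c ∈ B then 400 * 3 ^ m else -(200 * 3 ^ m) := by
      split_ifs with hcB
      · have := neg_le_pot us s' x
        rw [hlx] at this
        linarith
      · have h1 : ¬ reserve (3 ^ m) (fun w => s.color w = c) x us < 3 ^ m := by
          simpa [hB] using hcB
        have h2 := f2.reserve_le us
        have h3 : ((3 ^ m : ℕ) : ℝ) ≤ reserve (3 ^ s'.level x) (s'.Conflict x) x us := by
          exact_mod_cast (not_lt.1 h1).trans h2
        push_cast at h3
        rw [pot, hlx]
        rw [hlx] at h3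
        linarith
    have hexp : θ * (p + if c ∈ B then 400 * 3 ^ m else -(200 * 3 ^ m)) =
        θ * p + if c ∈ B then 2 * y else -y := by
      split_ifs <;> rw [hy] <;> ring
    rw [← Real.exp_add, ← hexp, weightAfter]
    cases hf : (finish x r c).1 with
    | none =>
      refine weight_le_of_inv hinv hθ ?_
      have := f2.idle_le h us
      have : (0 : ℝ) < 3 ^ s.level x := by positivity
      linarith
    | some z =>
      obtain ⟨z1, z2⟩ := f4 z (by simp [hf])
      refine weight_le_of_inv hinv hθ ?_
      have := f2.pending_le h us htime' z1 z2
      linarith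
  · rw [← Finset.mul_sum, mul_comm]
    refine mul_le_mul_of_nonneg_right ?_ (Real.exp_pos _).le
    refine sum_exp_le _ B ?_ hy0 hy1
    have := Finset.card_le_card (Finset.inter_subset_right (s₁ := (palette r x).toFinset) (s₂ := B))
    omega

theorem mean_recolor_le {G : SimpleGraph (Fin n)} (hdeg : ∀ v, (G.neighborSet v).ncard ≤ Δ)
    {s : State n Δ} (h : Inv G s) {θ : ℝ} (hθ : 0 ≤ θ) (hθ' : θ * (400 * n) ≤ 1)
    (us : List (Update n)) (x : Fin n) :
    mean (recolor x s) (weightAfter G θ us) ≤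
      ENNReal.ofReal (Real.exp (θ * (pending us s x + 100))) := by
  rw [recolor]
  split_ifs with hphi
  · obtain ⟨h1, ⟨c, h2⟩, h3⟩ := detColor_spec h x hphi
    rw [mean_pure]
    refine weight_le_of_inv h1 hθ ?_
    have h4 := h2.idle_le h us
    have h5 := neg_le_pot us (detColor x (State.tick 1 s)) x
    have hl : (detColor x (State.tick 1 s)).level x = 0 := by simp [h2.level]
    rw [hl, pow_zero] at h5
    have h3' : ((detColor x (State.tick 1 s)).time : ℝ) ≤ s.time + 100 * 3 ^ s.level x := by
      exact_mod_cast h3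
    linarith
  · exact mean_randColor_le hdeg h hθ hθ' us x hphi

/-- The bound on the number of iterations plays no role: a loop that is cut off leaves a state whose
amortized time is not larger than before the omitted call (`idle_le_pending`). -/
theorem mean_recolorLoop_le {G : SimpleGraph (Fin n)} (hdeg : ∀ v, (G.neighborSet v).ncard ≤ Δ)
    {θ : ℝ} (hθ : 0 ≤ θ) (hθ' : θ * (400 * n) ≤ 1) (us : List (Update n)) (k : ℕ) {s : State n Δ}
    (h : Inv G s) (x : Fin n) :
    mean (recolorLoop k x s) (weight G θ (idle us)) ≤
      ENNReal.ofReal (Real.exp (θ * (pending us s x + 100))) := by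
  induction k generalizing s x with
  | zero =>
    rw [recolorLoop, mean_pure]
    refine weight_le_of_inv h hθ ?_
    have := idle_le_pending us s x
    linarith
  | succ k ih =>
    rw [recolorLoop, mean_bind]
    refine (mean_mono _ fun p => ?_).trans (mean_recolor_le hdeg h hθ hθ' us x)
    rw [weightAfter]
    cases p.1 with
    | none => exact (mean_pure _ _).le
    | some y =>
      by_cases hp : Inv G p.2
      · simp only
        rw [weight_of_inv hp]
        exact ih hp y
      · simp only
        rw [weight_of_not_inv hp]
        exact le_top

theorem Frame.inv {k : ℕ} {G H : SimpleGraph (Fin n)} {s s' : State n Δ} (h : Frame k s s')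
    (hs : Inv G s) (hr : Rep H.Adj s') : Inv H s' :=
  ⟨hr, by rw [h.stamp, h.calls]; exact hs.stamp_le, by rw [h.level]; exact hs.pow_le_degree,
    by rw [h.level]; exact hs.pow_le_nodes⟩

theorem Frame.pot_eq {k : ℕ} {s s' : State n Δ} (h : Frame k s s') (us : List (Update n))
    (v : Fin n) : pot us s' v = pot us s v := by
  unfold pot
  rw [h.level]
  congr 3
  refine le_antisymm (reserve_mono _ _ _ ?_ _) (reserve_mono _ _ _ ?_ _) <;>
  · intro w
    rw [Conflict, Conflict, h.color, h.stamp]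
    exact id

theorem pot_cons_insert_le (s : State n Δ) (us : List (Update n)) (u v w : Fin n) :
    pot (.insert u v :: us) s w ≤
      pot us s w + ((if w = u then 10800 else 0) + if w = v then 10800 else 0) := by
  have h1 := reserve_cons_le (3 ^ s.level w) (s.Conflict w) w (.insert u v) us
  have h1' : (reserve (3 ^ s.level w) (s.Conflict w) w (.insert u v :: us) : ℝ) ≤
      18 + reserve (3 ^ s.level w) (s.Conflict w) w us := by exact_mod_cast h1
  unfold pot
  split_ifs with hu hv hv
  · linarith
  · linarith
  · linarith
  · rw [reserve_cons_of_none _ _ _ (by simp [Update.partner, hu, hv])]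
    linarith

theorem sum_pot_cons_insert_le (s : State n Δ) (us : List (Update n)) (u v : Fin n)
    (A : Finset (Fin n)) :
    ∑ w ∈ A, pot (.insert u v :: us) s w ≤ ∑ w ∈ A, pot us s w + 21600 := by
  calc ∑ w ∈ A, pot (.insert u v :: us) s w
      ≤ ∑ w ∈ A, (pot us s w + ((if w = u then 10800 else 0) + if w = v then 10800 else 0)) :=
        Finset.sum_le_sum fun w _ => pot_cons_insert_le s us u v w
    _ ≤ ∑ w ∈ A, pot us s w + 21600 := by
        rw [Finset.sum_add_distrib, Finset.sum_add_distrib, Finset.sum_ite_eq', Finset.sum_ite_eq']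
        split_ifs <;> linarith

theorem pot_cons_of_conflict_le {s : State n Δ} {e : Update n} {v w : Fin n}
    (he : e.partner v = some w) (hw : s.Conflict v w) (us : List (Update n)) :
    pot (e :: us) s v ≤ 10800 - 100 * 3 ^ s.level v := by
  have h1 := reserve_cons_of_some (3 ^ s.level v) (s.Conflict v) v he hw us
  have h1' : (reserve (3 ^ s.level v) (s.Conflict v) v (e :: us) : ℝ) ≤ 18 := by
    exact_mod_cast h1
  unfold pot
  linarith

/-- An update takes constant amortized time. -/
theorem mean_handle_le {G : SimpleGraph (Fin n)} {e : Update n} (he : e.Legal G)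
    (hdeg : ∀ v, ((e.apply G).neighborSet v).ncard ≤ Δ) {s : State n Δ} (h : Inv G s)
    {θ : ℝ} (hθ : 0 ≤ θ) (hθ' : θ * (400 * n) ≤ 1) (us : List (Update n)) :
    mean (handle s e) (weight (e.apply G) θ (idle us)) ≤
      ENNReal.ofReal (Real.exp (θ * (idle (e :: us) s + 32505))) := by
  cases e with
  | delete u v =>
    have he' : G.Adj u v := he
    have hf : Frame (1 + 4) s (unlink u v (State.tick 1 s)) :=
      (frame_tick 1 s).trans (frame_unlink u v (State.tick 1 s))
    have hrep : Rep ((Update.delete u v).apply G).Adj (unlink u v (State.tick 1 s)) := by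
      refine ((h.rep.tick 1).unlink he'.ne he' he'.symm).congr fun a b => ?_
      simp [Update.apply]
    rw [handle, mean_pure]
    refine weight_le_of_inv (hf.inv h hrep) hθ ?_
    have ht : ((unlink u v (State.tick 1 s)).time : ℝ) ≤ s.time + 5 := by
      exact_mod_cast hf.time
    have hpot : ∀ w, pot (.delete u v :: us) s w = pot us s w := by
      intro w
      unfold pot
      rw [reserve_cons_of_none _ _ _ rfl]
    simp only [idle, hf.pot_eq, hpot]
    linarith
  | insert u v =>
    obtain ⟨huv, hadj⟩ := he
    have hf : Frame (1 + 4) s (link u v (State.tick 1 s)) :=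
      (frame_tick 1 s).trans (frame_link u v (State.tick 1 s))
    have hrep : Rep ((Update.insert u v).apply G).Adj (link u v (State.tick 1 s)) := by
      refine ((h.rep.tick 1).link huv hadj (fun h' => hadj h'.symm)).congr fun a b => ?_
      simp only [Update.apply, SimpleGraph.sup_adj, SimpleGraph.edge_adj]
      grind
    have hinv := hf.inv h hrep
    have ht : ((link u v (State.tick 1 s)).time : ℝ) ≤ s.time + 5 := by
      exact_mod_cast hf.time
    rw [handle]
    by_cases hcol : s.color u = s.color v
    · rw [if_pos hcol]
      refine (mean_recolorLoop_le hdeg hθ hθ' us _ hinv _).trans ?_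
      refine ENNReal.ofReal_le_ofReal (Real.exp_le_exp.2 (mul_le_mul_of_nonneg_left ?_ hθ))
      -- `x` is in conflict with the other endpoint in the sense of `Conflict`, so before the update
      -- its potential is, up to a constant, the cost of its epoch with the opposite sign.
      set x := if s.stamp u < s.stamp v then v else u with hx
      have hpx : pot (.insert u v :: us) s x ≤ 10800 - 100 * 3 ^ s.level x := by
        rw [hx]
        split_ifs with hst
        · exact pot_cons_of_conflict_le (w := u) (by simp [Update.partner, huv.symm])
            ⟨huv, hcol, hst.le⟩ us
        · exact pot_cons_of_conflict_le (w := v) (by simp [Update.partner])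
            ⟨huv.symm, hcol.symm, not_lt.1 hst⟩ us
      have hsum := sum_pot_cons_insert_le s us u v (Finset.univ.erase x)
      rw [idle_eq _ s x, pending]
      simp only [hf.pot_eq, hf.level]
      linarith
    · rw [if_neg hcol, mean_pure]
      refine weight_le_of_inv hinv hθ ?_
      have hsum := sum_pot_cons_insert_le s us u v Finset.univ
      simp only [idle, hf.pot_eq]
      linarith

theorem time_le_idle {G : SimpleGraph (Fin n)} {s : State n Δ} (h : Inv G s)
    (us : List (Update n)) : (s.time : ℝ) - 500 * (Δ * n) ≤ idle us s := by
  have : ∑ v, pot us s v ≤ ∑ _v : Fin n, 500 * (Δ : ℝ) := by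
    refine Finset.sum_le_sum fun v _ => (State.pot_le us s v).trans ?_
    have : (3 : ℝ) ^ s.level v ≤ Δ := by exact_mod_cast h.pow_le_degree v
    linarith
  rw [Finset.sum_const, Finset.card_univ, Fintype.card_fin, nsmul_eq_mul] at this
  rw [idle]
  linarith

/-- At the end the potentials are replaced by the upper bound `500 * Δ * n` for their sum. -/
theorem mean_run_le {G : SimpleGraph (Fin n)} {us : List (Update n)} (hus : Admissible Δ G us)
    {s : State n Δ} (h : Inv G s) {θ : ℝ} (hθ : 0 ≤ θ) (hθ' : θ * (400 * n) ≤ 1) :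
    mean (run us s) (fun s' => ENNReal.ofReal (Real.exp (θ * (s'.time - 500 * (Δ * n))))) ≤
      ENNReal.ofReal (Real.exp (θ * (idle us s + 32505 * us.length))) := by
  induction us generalizing G s with
  | nil =>
    rw [run, mean_pure]
    refine ENNReal.ofReal_le_ofReal (Real.exp_le_exp.2 (mul_le_mul_of_nonneg_left ?_ hθ))
    have := time_le_idle h []
    simpa using this
  | cons e es ih =>
    obtain ⟨h1, h2, h3⟩ := hus
    have hsplit : ∀ F : ℝ, ENNReal.ofReal (Real.exp (θ * (F + 32505 * es.length))) =
        ENNReal.ofReal (Real.exp (θ * F)) *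
          ENNReal.ofReal (Real.exp (θ * (32505 * es.length))) := by
      intro F
      rw [← ENNReal.ofReal_mul (Real.exp_pos _).le, ← Real.exp_add, mul_add]
    rw [run, mean_bind]
    calc _ ≤ mean (handle s e) (fun s' => weight (e.apply G) θ (idle es) s' *
          ENNReal.ofReal (Real.exp (θ * (32505 * es.length)))) := by
          refine mean_mono _ fun s' => ?_
          by_cases hs' : Inv (e.apply G) s'
          · rw [weight_of_inv hs', ← hsplit]
            exact ih h3 hs'
          · rw [weight_of_not_inv hs', ENNReal.top_mul (by simp [Real.exp_pos])]
            exact le_top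
      _ ≤ ENNReal.ofReal (Real.exp (θ * (idle (e :: es) s + 32505))) *
          ENNReal.ofReal (Real.exp (θ * (32505 * es.length))) := by
          rw [mean_mul_const]
          exact mul_le_mul_left (mean_handle_le h1 h2 h hθ hθ' es) _
      _ = _ := by
          rw [← hsplit]
          congr 3
          push_cast [List.length_cons]
          ring

theorem idle_init_le (hn : 2 ≤ n) (hΔ : 0 < Δ) (χ₀ : Fin n → Fin (Δ + 1))
    (us : List (Update n)) :
    idle us (init χ₀) ≤ n * Real.log n + 115 * (Δ * n) := by
  have hsum : ∑ _v : Fin n, (-100 : ℝ) ≤ ∑ v, pot us (init χ₀) v := by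
    refine Finset.sum_le_sum fun v _ => ?_
    have := neg_le_pot us (init χ₀) v
    have hl : (init χ₀).level v = 0 := rfl
    rw [hl] at this
    linarith
  rw [Finset.sum_const, Finset.card_univ, Fintype.card_fin, nsmul_eq_mul] at hsum
  have hlog3 : 1 ≤ Real.log 3 := by
    rw [Real.le_log_iff_exp_le (by norm_num)]
    have := Real.exp_one_lt_d9
    linarith
  have hn' : (2 : ℝ) ≤ n := by exact_mod_cast hn
  have hΔ' : (1 : ℝ) ≤ Δ := by exact_mod_cast hΔ
  have hlog : 0 ≤ Real.log n := Real.log_nonneg (by linarith)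
  have htop : (topLevel n : ℝ) ≤ Real.log n + 1 := by
    have h1 : topLevel n ≤ Nat.clog 3 n := Nat.clog_mono_right _ (by omega)
    have h2 : Nat.clog 3 n = ⌈Real.logb 3 n⌉₊ := by
      rw [← Real.natCeil_logb_natCast]; norm_num
    have h3 : Real.logb 3 n ≤ Real.log n := div_le_self hlog hlog3
    have h4 : (⌈Real.logb 3 n⌉₊ : ℝ) < Real.logb 3 n + 1 :=
      Nat.ceil_lt_add_one (div_nonneg hlog (by linarith))
    rw [h2] at h1
    have h5 : (topLevel n : ℝ) ≤ ⌈Real.logb 3 n⌉₊ := by exact_mod_cast h1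
    linarith
  have ht : ((init χ₀).time : ℝ) = n * ((topLevel n + 1) + 3 * (Δ + 1) + 5) + (Δ + 1) := by
    have : (init χ₀).time = n * ((topLevel n + 1) + 3 * (Δ + 1) + 5) + (Δ + 1) := rfl
    rw [this]; push_cast; ring
  have hmul : (n : ℝ) * topLevel n ≤ n * (Real.log n + 1) := by gcongr
  have h1 : (n : ℝ) ≤ Δ * n := by nlinarith
  have h2 : (Δ : ℝ) ≤ Δ * n := by nlinarith
  rw [idle, ht]
  nlinarith

end State

/-! ### The tail of the running time -/

theorem totalTime_tail_le {n Δ : ℕ} (hn : 2 ≤ n) (hΔ : 0 < Δ) (χ₀ : Fin n → Fin (Δ + 1))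
    {us : List (Update n)} (hus : Admissible Δ (⊥ : SimpleGraph (Fin n)) us) {a : ℝ}
    (ha : 0 ≤ a) :
    (totalTime χ₀ us).toMeasure
      {T : ℕ | (T : ℝ) ≤ (40000 + 400 * a) * (us.length + n * Real.log n + Δ * n)}ᶜ ≤
      ENNReal.ofReal (1 / (n : ℝ) ^ a) := by
  have hn' : (0 : ℝ) < n := by
    have : 0 < n := by omega
    exact_mod_cast this
  have hlog : 0 ≤ Real.log n := Real.log_nonneg (by exact_mod_cast (by omega : 1 ≤ n))
  set X := (40000 + 400 * a) * (us.length + n * Real.log n + Δ * n) with hX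
  set θ : ℝ := 1 / (400 * n) with hθ
  have hθ0 : 0 ≤ θ := by positivity
  have hθn : θ * (400 * n) = 1 := by
    rw [hθ]; field_simp
  have hmean := State.mean_run_le hus (State.Inv.init hn hΔ χ₀) hθ0 hθn.le
  have hmarkov := toMeasure_mul_le_mean (totalTime χ₀ us)
    (fun T => ENNReal.ofReal (Real.exp (θ * (T - 500 * (Δ * n)))))
    (S := {T : ℕ | (T : ℝ) ≤ X}ᶜ) (MeasurableSet.of_discrete)
    (c := ENNReal.ofReal (Real.exp (θ * (X - 500 * (Δ * n))))) (by
      intro T hT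
      have hT' : X < T := by simpa using hT
      refine ENNReal.ofReal_le_ofReal (Real.exp_le_exp.2 (mul_le_mul_of_nonneg_left ?_ hθ0))
      linarith)
  rw [totalTime, mean_map] at hmarkov
  have hle := hmarkov.trans hmean
  rw [← ENNReal.le_div_iff_mul_le (by simp [Real.exp_pos]) (by simp),
    ← ENNReal.ofReal_div_of_pos (Real.exp_pos _), ← Real.exp_sub, ← mul_sub] at hle
  refine hle.trans (ENNReal.ofReal_le_ofReal ?_)
  have hinit := State.idle_init_le hn hΔ χ₀ us
  rw [one_div, ← Real.rpow_neg hn'.le, Real.rpow_def_of_pos hn']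
  refine Real.exp_le_exp.2 ?_
  have hkey : State.idle us (State.init χ₀) + 32505 * us.length - (X - 500 * (Δ * n)) ≤
      -(400 * n * (a * Real.log n)) := by
    have h1 : 0 ≤ a * (us.length : ℝ) := by positivity
    have h2 : 0 ≤ a * (Δ * n : ℝ) := by positivity
    have h3 : 0 ≤ n * Real.log n := by positivity
    have h4 : 0 ≤ (us.length : ℝ) := by positivity
    have h5 : 0 ≤ (Δ * n : ℝ) := by positivity
    rw [hX]
    nlinarith
  calc θ * (State.idle us (State.init χ₀) + 32505 * us.length - (X - 500 * (Δ * n)))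
      ≤ θ * -(400 * n * (a * Real.log n)) := mul_le_mul_of_nonneg_left hkey hθ0
    _ = -(θ * (400 * n)) * (a * Real.log n) := by ring
    _ = Real.log n * -a := by rw [hθn]; ring

end DynColoring

theorem mainTheorem2 :
    ∃ K : ℝ, 0 < K ∧ ∀ a : ℝ, 0 < a → ∃ C : ℝ, 0 < C ∧
      ∀ (n Δ : ℕ), 2 ≤ n → 0 < Δ →
        ∀ (χ₀ : Fin n → Fin (Δ + 1)) (us : List (DynColoring.Update n)),
          DynColoring.Admissible Δ (⊥ : SimpleGraph (Fin n)) us →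
            1 - K * (Real.log n / (n : ℝ) ^ a) ≤
              (DynColoring.totalTime χ₀ us).toMeasure.real
                {T : ℕ | (T : ℝ) ≤ C * (us.length + n * Real.log n + Δ * n)} := by
  have hlog2 : 0 < Real.log 2 := Real.log_pos (by norm_num)
  -- The failure probability is at most `n ^ (-a)`; the factor `log n` is only bounded below.
  refine ⟨1 / Real.log 2, by positivity, fun a ha => ⟨40000 + 400 * a, by positivity, ?_⟩⟩
  intro n Δ hn hΔ χ₀ us hus
  have htail := DynColoring.totalTime_tail_le hn hΔ χ₀ hus ha.le
  set S := {T : ℕ | (T : ℝ) ≤ (40000 + 400 * a) * (us.length + n * Real.log n + Δ * n)}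
  have hn' : (2 : ℝ) ≤ n := by exact_mod_cast hn
  have hpow : 0 < (n : ℝ) ^ a := Real.rpow_pos_of_pos (by linarith) a
  have hreal : (DynColoring.totalTime χ₀ us).toMeasure.real Sᶜ ≤ 1 / (n : ℝ) ^ a :=
    ENNReal.toReal_le_of_le_ofReal (by positivity) htail
  rw [MeasureTheory.probReal_compl_eq_one_sub MeasurableSet.of_discrete] at hreal
  have hlog : Real.log 2 ≤ Real.log n := Real.log_le_log (by norm_num) hn'
  have hK : 1 / (n : ℝ) ^ a ≤ 1 / Real.log 2 * (Real.log n / (n : ℝ) ^ a) := by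
    rw [div_mul_div_comm, one_mul, div_le_div_iff₀ hpow (by positivity)]
    nlinarith
  linarith
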